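/- All graphs are finite and simple. A *graph-labelled tree* (GLT) consists of a tree $T$ in which every non-leaf vertex (*node*) $u$ has degree at least $3$ and is labelled by a graph $G(u)$ whose vertex set $V(u)$ (the *marker vertices* of $u$) is in bijection with the tree-edges incident to $u$. The *extremities* of a tree-edge are the marker vertices (or leaves) representing it at its two ends; each is the *opposite* of the other. Two extremities are *accessible* from one another if they are joined by a (possibly one-element) sequence of extremities in which consecutive elements are alternately the two extremities of a tree-edge and the two ends of an edge of a label. The *accessibility graph* of the GLT is the graph on the leaves of $T$ in which two distinct leaves are adjacent iff they are accessible from one another. A *split* of a connected graph $H$ is a bipartition $(A,B)$ of its vertices with $|A|,|B|>1$ such that every vertex of $N(B)$ is adjacent to every vertex of $N(A)$, where $N(X)$ is the set of vertices outside $X$ with a neighbour in $X$. A connected graph without a split is *prime*; a graph is *degenerate* if it is a clique or a star (a star has at least three vertices). A node is called clique, star, prime or degenerate according to its label. A GLT is *reduced* if every node is prime or degenerate, no two adjacent nodes are both cliques, and no two adjacent nodes are both stars with exactly one extremity of their common tree-edge being the centre of its star. For a connected graph $G$, the *split-tree* $ST(G)$ is the reduced GLT whose accessibility graph is $G$. For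 an extremity $q$ of a tree-edge $e$, let $L(q)$ be the set of leaves of $T$ from which the path to the node (or leaf) of $q$ uses $e$, and let $A(q)$ be the set of leaves in $L(q)$ accessible from $q$. Given a set $S$ of leaves, $q$ is *perfect* if $S\cap L(q)=A(q)$, *empty* if $S\cap L(q)=\emptyset$, and *mixed* otherwise. For a node $u$, let $P(u)$ be the set of perfect marker vertices of $u$; $u$ is *hybrid* if every marker vertex of $u$ is perfect or empty and has a mixed opposite. For a degenerate node $u$, let $P^*(u)$ be the set of marker vertices of $u$ that are perfect and not the centre of a star, and $E^*(u)$ the set of those that are empty, or perfect and the centre of a star. The *node-split* of a node $v$ with respect to a split $(A,B)$ of $G(v)$ replaces $v$ by two adjacent nodes with labels $G(v)[A]+q$ and $G(v)[B]+q'$, where $q,q'$ are the extremities of the new tree-edge, $q$ is adjacent exactly to $N(B)$ and $q'$ exactly to $N(A)$; all other tree-edges keep their extremities. *Subdividing* a tree-edge $e$ with a ternary node attached to $x$ means replacing $e$ by a new node with three marker vertices, whose opposites are the two extremities of $e$ and a new leaf $x$. **Statement.** Let $G$ be a connected graph, $x\notin V(G)$, and let $G+x$ be the graph obtained by adding $x$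 adjacent to a set $N(x)\subseteq V(G)$; assume that $G+x$ is connected. Let $ST(G)$ be marked with states with respect to $S=N(x)$. 1. *(Cases 1, 2, 3.)* Suppose $ST(G)$ contains - a unique clique node $u$ whose marker vertices are all perfect, or - a unique star node $u$ whose marker vertices are all empty except its centre, which is perfect, or - a unique hybrid node $u$, and $u$ is prime. Then $ST(G+x)$ is obtained by adding to the node $u$ a marker vertex $q$ adjacent in $G(u)$ exactly to $P(u)$, and making the new leaf $x$ the opposite of $q$. 2. *(Case 4.)* Suppose $ST(G)$ contains a unique hybrid node $u$, and $u$ is degenerate. Then $(P^*(u),E^*(u))$ is a split of $G(u)$, and the node-split of $u$ with respect to it creates a tree-edge $e$ each of whose extremities is perfect or empty, not both of them being empty. $ST(G+x)$ is obtained from the resulting GLT by subdividing $e$ with a new ternary node attached to $x$; this node is a clique if both extremities of $e$ are perfect, and otherwise it is a star whose centre is the opposite of the empty extremity of $e$. 3. *(Case 5.)* Suppose $ST(G)$ contains a unique tree-edge $e$ both of whose extremities are perfect. Then $ST(G+x)$ is obtained by subdividing $e$ with a new ternary clique node attached to $x$. 4. *(Case 6.)* Suppose $ST(G)$ contains a unique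 tree-edge $e$ one of whose extremities is perfect and the other empty. Then $ST(G+x)$ is obtained by subdividing $e$ with a new ternary star node attached to $x$, whose centre is the opposite of the empty extremity of $e$. -/

import Mathlib

/-! ### Splits, prime graphs, cliques and stars -/

/-- `N(S)`: the vertices outside `S` that have a neighbour in `S`. -/
def setNeighbors {W : Type*} (H : SimpleGraph W) (S : Set W) : Set W :=
  {v | v ∉ S ∧ ∃ s ∈ S, H.Adj s v}

/-- `(A, B)` is a split of `H`: a bipartition of the vertices with `|A|, |B| > 1` such that every
vertex of `N(B)` (the frontier in `A`) is adjacent to every vertex of `N(A)` (the frontier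
in `B`). -/
def IsSplit {W : Type*} (H : SimpleGraph W) (A B : Set W) : Prop :=
  IsCompl A B ∧ A.Nontrivial ∧ B.Nontrivial ∧
    ∀ a ∈ setNeighbors H B, ∀ b ∈ setNeighbors H A, H.Adj a b

/-- A (connected) graph is prime if it has no split. -/
def IsPrimeGraph {W : Type*} (H : SimpleGraph W) : Prop :=
  H.Connected ∧ ∀ A B : Set W, ¬ IsSplit H A B

/-- Every two distinct vertices are adjacent. -/
def IsCliqueGraph {W : Type*} (H : SimpleGraph W) : Prop := H = ⊤

/-- `H` is a star (on at least three vertices) with centre `c`: `c` is adjacent to every other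
vertex and there are no other edges. -/
def IsStarWithCentre {W : Type*} (H : SimpleGraph W) (c : W) : Prop :=
  3 ≤ Nat.card W ∧ H = SimpleGraph.starGraph c

/-- `H` is a star. -/
def IsStarGraph {W : Type*} (H : SimpleGraph W) : Prop := ∃ c, IsStarWithCentre H c

/-- `H` is a clique or a star. -/
def IsDegenerate {W : Type*} (H : SimpleGraph W) : Prop := IsCliqueGraph H ∨ IsStarGraph H

/-- `G + (x, S)`: a new vertex `x = none` is added to `G`, adjacent exactly to the vertices
in `S`. -/
def addVertex {V : Type*} (G : SimpleGraph V) (S : Set V) : SimpleGraph (Option V) where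
  Adj
    | some v, some w => G.Adj v w
    | some v, none => v ∈ S
    | none, some v => v ∈ S
    | none, none => False
  symm := ⟨fun a b h => by
    cases a <;> cases b <;> first | exact h | exact h.symm⟩
  loopless := ⟨fun a h => by
    cases a <;> first | exact h | exact G.irrefl h⟩

/-! ### Graph-labelled trees -/

/-- The data of a graph-labelled tree with leaves `V`, nodes `N` and marker vertices `M`.
`node m` is the node whose label contains the marker vertex `m`; `labels` is the disjoint union of
all the labels; and `opp` sends an extremity (a marker vertex or a leaf) of a tree-edge to the
other extremity of this tree-edge. The axioms of a graph-labelled tree are in `PreGLT.IsGLT`. -/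
structure PreGLT (V N M : Type*) where
  node : M → N
  labels : SimpleGraph M
  opp : M ⊕ V → M ⊕ V
  opp_opp : ∀ p, opp (opp p) = p
  opp_ne : ∀ p, opp p ≠ p

namespace PreGLT

variable {V N M : Type*} (Γ : PreGLT V N M)

/-- The vertex of the tree at which an extremity lies: the node of a marker vertex, and a leaf
itself. -/
def loc : M ⊕ V → N ⊕ V := Sum.map Γ.node id

/-- The tree `T`. Its vertices are the nodes and the leaves. Each pair `{p, opp p}` is (the pair of
extremities of) one tree-edge. -/
def tree : SimpleGraph (N ⊕ V) where
  Adj a b := a ≠ b ∧ ∃ p, Γ.loc p = a ∧ Γ.loc (Γ.opp p) = b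
  symm := ⟨fun _ _ ⟨hne, p, ha, hb⟩ =>
    ⟨hne.symm, Γ.opp p, hb, by rw [Γ.opp_opp]; exact ha⟩⟩
  loopless := ⟨fun _ h => h.1 rfl⟩

/-- `V(u)`, the marker vertices of the node `u`. -/
def markers (u : N) : Set M := {m | Γ.node m = u}

/-- The label `G(u)` of the node `u`. -/
def label (u : N) : SimpleGraph (Γ.markers u) := Γ.labels.induce (Γ.markers u)

/-- The axioms of a graph-labelled tree: label-edges join marker vertices of the same node; every
`{p, opp p}` is an edge of the tree, and the marker vertices of a node are in bijection with the
tree-edges at this node (different extremities at the same place belong to different edges);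
`T` is a tree; every node has at least three incident tree-edges. -/
structure IsGLT : Prop where
  node_eq : ∀ a b, Γ.labels.Adj a b → Γ.node a = Γ.node b
  loc_ne : ∀ p, Γ.loc p ≠ Γ.loc (Γ.opp p)
  inj : ∀ p q, Γ.loc p = Γ.loc q → Γ.loc (Γ.opp p) = Γ.loc (Γ.opp q) → p = q
  isTree : Γ.tree.IsTree
  three_le : ∀ u, 3 ≤ (Γ.markers u).ncard

/-- `AltSeq b p q`: there is a sequence of extremities from `p` to `q` whose consecutive elements
are joined alternately by tree-edges and label-edges; if there is a first edge, it is a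
tree-edge for `b = true` and a label-edge for `b = false`. -/
inductive AltSeq : Bool → M ⊕ V → M ⊕ V → Prop
  | nil (b : Bool) (p : M ⊕ V) : AltSeq b p p
  | treeEdge {p r : M ⊕ V} : AltSeq false (Γ.opp p) r → AltSeq true p r
  | labelEdge {m m' : M} {r : M ⊕ V} : Γ.labels.Adj m m' → AltSeq true (Sum.inl m') r →
      AltSeq false (Sum.inl m) r

/-- Two extremities (marker vertices or leaves) are accessible from one another. -/
def Accessible (p q : M ⊕ V) : Prop := ∃ b, Γ.AltSeq b p q

theorem AltSeq.reverse_append {Γ : PreGLT V N M} {b : Bool} {p q : M ⊕ V} (h : Γ.AltSeq b p q) :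
    ∀ r, Γ.AltSeq (!b) p r → Γ.Accessible q r := by
  induction h with
  | nil b p => exact fun r hr => ⟨_, hr⟩
  | @treeEdge p _ _ ih =>
    intro r hr
    refine ih r (AltSeq.treeEdge ?_)
    rw [Γ.opp_opp]
    exact hr
  | labelEdge hadj _ ih => exact fun r hr => ih r (AltSeq.labelEdge hadj.symm hr)

theorem Accessible.symm {Γ : PreGLT V N M} {p q : M ⊕ V} (h : Γ.Accessible p q) :
    Γ.Accessible q p := by
  obtain ⟨b, hb⟩ := h
  exact hb.reverse_append p (AltSeq.nil _ _)

/-- The accessibility graph `Gr(T, F)` on the leaves. -/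
def accessibilityGraph : SimpleGraph V where
  Adj v w := v ≠ w ∧ Γ.Accessible (Sum.inr v) (Sum.inr w)
  symm := ⟨fun _ _ h => ⟨h.1.symm, h.2.symm⟩⟩
  loopless := ⟨fun _ h => h.1 rfl⟩

/-! ### Reduced graph-labelled trees and the split-tree -/

/-- The marker vertex `m` is the centre of a star. -/
def IsCentre (m : M) : Prop := IsStarWithCentre (Γ.label (Γ.node m)) ⟨m, rfl⟩

/-- All labels are prime or degenerate, and no clique-join and no star-join is possible. -/
structure IsReduced : Prop where
  prime_or_degenerate : ∀ u, IsPrimeGraph (Γ.label u) ∨ IsDegenerate (Γ.label u)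
  no_clique_join : ∀ m m', Γ.opp (Sum.inl m) = Sum.inl m' →
    ¬ (IsCliqueGraph (Γ.label (Γ.node m)) ∧ IsCliqueGraph (Γ.label (Γ.node m')))
  no_star_join : ∀ m m', Γ.opp (Sum.inl m) = Sum.inl m' →
    ¬ (IsStarGraph (Γ.label (Γ.node m)) ∧ IsStarGraph (Γ.label (Γ.node m')) ∧
        Xor (Γ.IsCentre m) (Γ.IsCentre m'))

/-- `Γ` is the split-tree `ST(G)`: a reduced graph-labelled tree with accessibility graph `G`. -/
structure IsSplitTree (G : SimpleGraph V) : Prop where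
  isGLT : Γ.IsGLT
  isReduced : Γ.IsReduced
  accessibilityGraph_eq : Γ.accessibilityGraph = G

/-! ### States with respect to a set `S` of leaves -/

/-- `L(p)`: the leaves from which the path to the location of `p` uses the tree-edge of `p`. -/
def L (p : M ⊕ V) : Set V :=
  {l | ∃ w : Γ.tree.Walk (Sum.inr l) (Γ.loc p),
    w.IsPath ∧ s(Γ.loc p, Γ.loc (Γ.opp p)) ∈ w.edges}

/-- `A(p)`: the leaves of `L(p)` that are accessible from `p`. -/
def A (p : M ⊕ V) : Set V := {l | l ∈ Γ.L p ∧ Γ.Accessible p (Sum.inr l)}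

def IsPerfect (S : Set V) (p : M ⊕ V) : Prop := S ∩ Γ.L p = Γ.A p

def IsEmptyState (S : Set V) (p : M ⊕ V) : Prop := S ∩ Γ.L p = ∅

def IsMixed (S : Set V) (p : M ⊕ V) : Prop := ¬ Γ.IsPerfect S p ∧ ¬ Γ.IsEmptyState S p

/-- `P(u)`. -/
def P (S : Set V) (u : N) : Set M := {m | m ∈ Γ.markers u ∧ Γ.IsPerfect S (Sum.inl m)}

/-- `P*(u)`: the perfect marker vertices of `u` that are not the centre of a star. -/
def PStar (S : Set V) (u : N) : Set M :=
  {m | m ∈ Γ.markers u ∧ Γ.IsPerfect S (Sum.inl m) ∧ ¬ Γ.IsCentre m}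

/-- `E*(u)`: the marker vertices of `u` that are empty, or perfect and the centre of a star. -/
def EStar (S : Set V) (u : N) : Set M :=
  {m | m ∈ Γ.markers u ∧
    (Γ.IsEmptyState S (Sum.inl m) ∨ (Γ.IsPerfect S (Sum.inl m) ∧ Γ.IsCentre m))}

/-- `u` is a hybrid node. -/
def IsHybrid (S : Set V) (u : N) : Prop :=
  ∀ m ∈ Γ.markers u, (Γ.IsPerfect S (Sum.inl m) ∨ Γ.IsEmptyState S (Sum.inl m)) ∧
    Γ.IsMixed S (Γ.opp (Sum.inl m))

/-- `u` is a clique node whose marker vertices are all perfect. -/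
def IsPerfectClique (S : Set V) (u : N) : Prop :=
  IsCliqueGraph (Γ.label u) ∧ ∀ m ∈ Γ.markers u, Γ.IsPerfect S (Sum.inl m)

/-- `u` is a star node whose marker vertices are all empty except its centre, which is perfect. -/
def IsEmptyStar (S : Set V) (u : N) : Prop :=
  ∃ c : Γ.markers u, IsStarWithCentre (Γ.label u) c ∧ Γ.IsPerfect S (Sum.inl c.1) ∧
    ∀ m ∈ Γ.markers u, m ≠ c.1 → Γ.IsEmptyState S (Sum.inl m)

/-- The tree-edge `{p, opp p}` has two perfect extremities. -/
def IsPPEdge (S : Set V) (p : M ⊕ V) : Prop := Γ.IsPerfect S p ∧ Γ.IsPerfect S (Γ.opp p)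

/-- In the tree-edge `{p, opp p}`, the extremity `p` is perfect and `opp p` is empty. -/
def IsPEEdge (S : Set V) (p : M ⊕ V) : Prop := Γ.IsPerfect S p ∧ Γ.IsEmptyState S (Γ.opp p)

/-! ### Operations -/

/-- Add to the node `u` a new marker vertex `none`, adjacent in `G(u)` to the marker vertices
in `Q`, whose opposite is a new leaf `none`. -/
def addMarker (u : N) (Q : Set M) : PreGLT (Option V) N (Option M) where
  node m := m.elim u Γ.node
  labels := addVertex Γ.labels Q
  opp
    | Sum.inl none => Sum.inr none
    | Sum.inr none => Sum.inl none
    | Sum.inl (some m) => Sum.map some some (Γ.opp (Sum.inl m))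
    | Sum.inr (some v) => Sum.map some some (Γ.opp (Sum.inr v))
  opp_opp := by
    have key : ∀ p q : M ⊕ V, Γ.opp p = q → Γ.opp q = p := by
      intro p q h
      rw [← h, Γ.opp_opp]
    rintro ((_ | m) | (_ | v))
    · rfl
    · cases h : Γ.opp (Sum.inl m) with
      | inl a => simp [h, key _ _ h]
      | inr a => simp [h, key _ _ h]
    · rfl
    · cases h : Γ.opp (Sum.inr v) with
      | inl a => simp [h, key _ _ h]
      | inr a => simp [h, key _ _ h]
  opp_ne := by
    rintro ((_ | m) | (_ | v))
    · simp
    · have := Γ.opp_ne (Sum.inl m)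
      cases h : Γ.opp (Sum.inl m) <;> simp_all
    · simp
    · have := Γ.opp_ne (Sum.inr v)
      cases h : Γ.opp (Sum.inr v) <;> simp_all

open Classical in
/-- The node-split of the node `u` with respect to the bipartition `(A, B)` of its marker vertices.
`u` is replaced by the node `some u` with label `G[A] + q` and the node `none` with label
`G[B] + q'`, where the new marker vertices `q = Sum.inr true` and `q' = Sum.inr false` are opposite
and are adjacent to the frontiers `A' = N(B)` and `B' = N(A)`. The other nodes `w` become
`some w`. -/
noncomputable def nodeSplit (u : N) (A B : Set M) : PreGLT V (Option N) (M ⊕ Bool) where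
  node
    | Sum.inl m => if m ∈ B then none else some (Γ.node m)
    | Sum.inr true => some u
    | Sum.inr false => none
  labels :=
    { Adj := fun
        | Sum.inl a, Sum.inl b => Γ.labels.Adj a b ∧ ¬ (a ∈ A ∧ b ∈ B) ∧ ¬ (a ∈ B ∧ b ∈ A)
        | Sum.inl a, Sum.inr true => a ∈ A ∩ setNeighbors Γ.labels B
        | Sum.inr true, Sum.inl a => a ∈ A ∩ setNeighbors Γ.labels B
        | Sum.inl b, Sum.inr false => b ∈ B ∩ setNeighbors Γ.labels A
        | Sum.inr false, Sum.inl b => b ∈ B ∩ setNeighbors Γ.labels A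
        | Sum.inr _, Sum.inr _ => False
      symm := ⟨by
        rintro (a | (_ | _)) (b | (_ | _)) h
        · exact ⟨h.1.symm, fun k => h.2.2 k.symm, fun k => h.2.1 k.symm⟩
        all_goals exact h⟩
      loopless := ⟨by
        rintro (a | (_ | _)) h
        · exact Γ.labels.irrefl h.1
        all_goals exact h⟩ }
  opp
    | Sum.inl (Sum.inl m) => Sum.map Sum.inl id (Γ.opp (Sum.inl m))
    | Sum.inr v => Sum.map Sum.inl id (Γ.opp (Sum.inr v))
    | Sum.inl (Sum.inr b) => Sum.inl (Sum.inr (!b))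
  opp_opp := by
    have key : ∀ p q : M ⊕ V, Γ.opp p = q → Γ.opp q = p := by
      intro p q h
      rw [← h, Γ.opp_opp]
    rintro ((m | b) | v)
    · cases h : Γ.opp (Sum.inl m) with
      | inl a => simp [h, key _ _ h]
      | inr a => simp [h, key _ _ h]
    · simp
    · cases h : Γ.opp (Sum.inr v) with
      | inl a => simp [h, key _ _ h]
      | inr a => simp [h, key _ _ h]
  opp_ne := by
    rintro ((m | b) | v)
    · have := Γ.opp_ne (Sum.inl m)
      cases h : Γ.opp (Sum.inl m) <;> simp_all
    · simp
    · have := Γ.opp_ne (Sum.inr v)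
      cases h : Γ.opp (Sum.inr v) <;> simp_all

/-- The extremity `q` (lying at the node with label `G[A] + q`) of the tree-edge created by a
node-split. -/
def splitExt : (M ⊕ Bool) ⊕ V := Sum.inl (Sum.inr true)

/-- The extremity `q'` (lying at the node with label `G[B] + q'`) of the tree-edge created by a
node-split. -/
def splitExt' : (M ⊕ Bool) ⊕ V := Sum.inl (Sum.inr false)

/-- The node-split of the node `u` with respect to `(P*(u), E*(u))`. -/
noncomputable def starSplit (S : Set V) (u : N) : PreGLT V (Option N) (M ⊕ Bool) :=
  Γ.nodeSplit u (Γ.PStar S u) (Γ.EStar S u)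

/-- The embedding of the old extremities when a tree-edge is subdivided. -/
def oldExt : M ⊕ V → (M ⊕ Fin 3) ⊕ Option V := Sum.map Sum.inl some

open Classical in
/-- The opposites of the old extremities after the subdivision of the tree-edge `{p, opp p}`. -/
noncomputable def subdivideOpp (p e : M ⊕ V) : (M ⊕ Fin 3) ⊕ Option V :=
  if e = p then Sum.inl (Sum.inr 0)
  else if e = Γ.opp p then Sum.inl (Sum.inr 1)
  else oldExt (Γ.opp e)

theorem subdivideOpp_of_ne {p e : M ⊕ V} (h₁ : e ≠ p) (h₂ : e ≠ Γ.opp p) :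
    Γ.subdivideOpp p e = oldExt (Γ.opp e) ∧
      Γ.subdivideOpp p (Γ.opp e) = oldExt e := by
  have h₃ : Γ.opp e ≠ p := fun h => h₂ (by rw [← h, Γ.opp_opp])
  have h₄ : Γ.opp e ≠ Γ.opp p := fun h => h₁ (by rw [← Γ.opp_opp e, h, Γ.opp_opp])
  constructor
  · simp [subdivideOpp, h₁, h₂]
  · simp [subdivideOpp, h₃, h₄, Γ.opp_opp]

/-- Subdivide the tree-edge `{p, opp p}` with a new ternary node `none`, to which a new leaf `none`
is attached. Its label is `K` on the new marker vertices `0`, `1`, `2`, which are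
opposite `p`, `opp p` and the new leaf respectively. -/
noncomputable def subdivide (p : M ⊕ V) (K : SimpleGraph (Fin 3)) :
    PreGLT (Option V) (Option N) (M ⊕ Fin 3) where
  node
    | Sum.inl m => some (Γ.node m)
    | Sum.inr _ => none
  labels := Γ.labels ⊕g K
  opp
    | Sum.inl (Sum.inl m) => Γ.subdivideOpp p (Sum.inl m)
    | Sum.inr (some v) => Γ.subdivideOpp p (Sum.inr v)
    | Sum.inl (Sum.inr 0) => oldExt p
    | Sum.inl (Sum.inr 1) => oldExt (Γ.opp p)
    | Sum.inl (Sum.inr 2) => Sum.inr none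
    | Sum.inr none => Sum.inl (Sum.inr 2)
  opp_opp := by
    set g : (M ⊕ Fin 3) ⊕ Option V → (M ⊕ Fin 3) ⊕ Option V := fun
      | Sum.inl (Sum.inl m) => Γ.subdivideOpp p (Sum.inl m)
      | Sum.inr (some v) => Γ.subdivideOpp p (Sum.inr v)
      | Sum.inl (Sum.inr 0) => oldExt p
      | Sum.inl (Sum.inr 1) => oldExt (Γ.opp p)
      | Sum.inl (Sum.inr 2) => Sum.inr none
      | Sum.inr none => Sum.inl (Sum.inr 2) with hg
    have hold : ∀ e, g (oldExt e) = Γ.subdivideOpp p e := by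
      rintro (m | v) <;> rfl
    have h0 : Γ.subdivideOpp p p = Sum.inl (Sum.inr 0) := by simp [subdivideOpp]
    have h1 : Γ.subdivideOpp p (Γ.opp p) = Sum.inl (Sum.inr 1) := by
      simp [subdivideOpp, Γ.opp_ne p]
    have key : ∀ e, g (Γ.subdivideOpp p e) = oldExt e := by
      intro e
      by_cases he : e = p
      · subst he; rw [h0]
      by_cases he' : e = Γ.opp p
      · subst he'; rw [h1]
      · obtain ⟨k₁, k₂⟩ := Γ.subdivideOpp_of_ne he he'
        rw [k₁, hold, k₂]
    change ∀ e, g (g e) = e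
    rintro ((m | i) | (_ | v))
    · exact key (Sum.inl m)
    · fin_cases i
      · exact (hold p).trans h0
      · exact (hold _).trans h1
      · rfl
    · rfl
    · exact key (Sum.inr v)
  opp_ne := by
    have key : ∀ e, Γ.subdivideOpp p e ≠ oldExt e := by
      intro e
      by_cases he : e = p
      · subst he; cases e <;> simp [subdivideOpp, oldExt]
      by_cases he' : e = Γ.opp p
      · simp only [subdivideOpp, he, if_false, if_pos he']
        cases e <;> simp [oldExt]
      · obtain ⟨k₁, -⟩ := Γ.subdivideOpp_of_ne he he'
        rw [k₁]
        intro h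
        refine Γ.opp_ne e ?_
        revert h
        cases Γ.opp e <;> cases e <;> simp [oldExt]
    rintro ((m | i) | (_ | v))
    · exact key (Sum.inl m)
    · fin_cases i
      · cases p <;> simp [oldExt]
      · cases Γ.opp p <;> simp [oldExt]
      · simp
    · simp
    · exact key (Sum.inr v)

end PreGLT

/-! ### Closer neighbours in a tree -/

/-! Each case requires three facts about the modified object: it is a graph-labelled tree, its
accessibility graph is `G + x`, and it is reduced.

For the first fact, extremities correspond to the darts of the tree. Hence a connected tree of nodes
and leaves satisfies the axioms once it has few enough extremities (`isGLT_of_connected`), and each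
operation leaves this count balanced.

For the second, `L` and `A` obey a recursion. If `opp p` is a leaf `v`, both sets are `{v}`. If `opp
p` is a marker vertex `m`, then `L p` is the disjoint union of the `L m'` over the other marker
vertices `m'` of that node, and `A p` is the union of the `A m'` over the neighbours `m'` of `m`.
Induction on the part of the tree beyond `p` (`IsGLT.induction`) shows that the operations do not
change accessibility between old leaves. The new leaf sees exactly `S`, because `S` is the union of
the sets `A` of the perfect extremities at the insertion place, the other ones there being empty.

The recursion also makes states local (`IsGLT.isPerfect_iff_of_opp_inl`): `p` with opposite `m` is
perfect iff the neighbours of `m` are perfect and the remaining marker vertices of the node, other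
than `m`, are empty. Reducedness rests on this. At a hybrid node, an opposite that is not empty says
that `x` is not pendant, and an opposite that is not perfect says that `x` is not a twin. A prime
label therefore stays prime (`IsPrimeGraph.addVertex`), and in a degenerate label both `P*` and `E*`
have at least two elements (`IsSplitTree.isNodeSplit_starSplit`). In cases 5 and 6, a forbidden join
with the new ternary node would force every tree-edge at an adjacent clique or star to have the same
pair of states. Such a node has at least three tree-edges, contrary to uniqueness. In case 4 the
edge created by the node-split may itself be a clique-join or a star-join, and subdividing it
removes the obstruction. -/

theorem SimpleGraph.IsTree.closer_neighbor_unique {W : Type*} {T : SimpleGraph W} (hT : T.IsTree)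
    {x a b c : W} (hb : T.Adj b a) (hc : T.Adj c a) (hxb : T.dist x b < T.dist x a)
    (hxc : T.dist x c < T.dist x a) : b = c := by
  have key : ∀ d, T.Adj d a → T.dist x d < T.dist x a →
      ∃ w : T.Walk x a, w.IsPath ∧ w.penultimate = d := by
    intro d hd hlt
    obtain ⟨w, hw⟩ := hT.connected.exists_walk_length_eq_dist x d
    -- A shortest walk to `d` followed by the edge to `a` has length `dist x a`, so it is the unique
    -- path from `x` to `a`; hence `d` is determined as its penultimate vertex.
    refine ⟨w.concat hd, SimpleGraph.Walk.isPath_of_length_eq_dist _ ?_, by simp⟩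
    have := hT.dist_eq_dist_add_one_of_adj x hd
    rw [SimpleGraph.Walk.length_concat, hw]
    omega
  obtain ⟨w₁, h₁, rfl⟩ := key b hb hxb
  obtain ⟨w₂, h₂, rfl⟩ := key c hc hxc
  rw [(hT.existsUnique_path x a).unique h₁ h₂]

theorem SimpleGraph.Connected.exists_closer_neighbor {W : Type*} {T : SimpleGraph W}
    (hT : T.Connected) {x a : W} (h : x ≠ a) : ∃ b, T.Adj a b ∧ T.dist x b < T.dist x a := by
  obtain ⟨w, hw⟩ := hT.exists_walk_length_eq_dist a x
  cases w with
  | nil => exact absurd rfl h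
  | cons hadj w =>
    refine ⟨_, hadj, ?_⟩
    rw [SimpleGraph.dist_comm, SimpleGraph.dist_comm (u := x), ← hw, SimpleGraph.Walk.length_cons]
    exact Nat.lt_succ_of_le (SimpleGraph.dist_le w)

namespace PreGLT

variable {V N M : Type*} {Γ : PreGLT V N M}

@[simp] theorem loc_inl (m : M) : Γ.loc (Sum.inl m) = Sum.inl (Γ.node m) := rfl

@[simp] theorem loc_inr (v : V) : Γ.loc (Sum.inr v) = Sum.inr v := rfl

theorem opp_eq_comm {p q : M ⊕ V} (h : Γ.opp p = q) : Γ.opp q = p := by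
  rw [← h, Γ.opp_opp]

/-! ### The two sides of a tree-edge -/

/-- The tree-vertices lying beyond the tree-edge of `p`, as seen from the location of `p`. -/
def Side (Γ : PreGLT V N M) (p : M ⊕ V) : Set (N ⊕ V) :=
  {a | Γ.tree.dist a (Γ.loc (Γ.opp p)) < Γ.tree.dist a (Γ.loc p)}

theorem IsGLT.adj (h : Γ.IsGLT) (p : M ⊕ V) : Γ.tree.Adj (Γ.loc p) (Γ.loc (Γ.opp p)) :=
  ⟨h.loc_ne p, p, rfl, rfl⟩

/-- In a tree the distances from a vertex to the two ends of an edge differ by exactly one, so the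
two sides are complementary. -/
theorem IsGLT.mem_side_opp (h : Γ.IsGLT) (p : M ⊕ V) (a : N ⊕ V) :
    a ∈ Γ.Side (Γ.opp p) ↔ a ∉ Γ.Side p := by
  have := h.isTree.dist_eq_dist_add_one_of_adj a (h.adj p)
  simp only [Side, Set.mem_ofPred_eq, Γ.opp_opp]
  omega

theorem IsGLT.loc_opp_mem_side (h : Γ.IsGLT) (p : M ⊕ V) : Γ.loc (Γ.opp p) ∈ Γ.Side p := by
  have := h.isTree.dist_eq_dist_add_one_of_adj (Γ.loc (Γ.opp p)) (h.adj p)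
  simp only [Side, Set.mem_ofPred_eq]
  rw [SimpleGraph.dist_self] at *
  omega

theorem loc_notMem_side (p : M ⊕ V) : Γ.loc p ∉ Γ.Side p := by
  simp [Side]

/-- Together with `side_unique`: seen from a tree-vertex, every other one lies beyond exactly one
extremity, the one leading to the unique closer neighbour. -/
theorem IsGLT.exists_mem_side (h : Γ.IsGLT) {a b : N ⊕ V} (hab : a ≠ b) :
    ∃ p, Γ.loc p = a ∧ b ∈ Γ.Side p := by
  obtain ⟨c, ⟨-, p, hp, hc⟩, hlt⟩ := h.isTree.connected.exists_closer_neighbor hab.symm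
  refine ⟨p, hp, ?_⟩
  rw [Side, Set.mem_ofPred_eq, hp, hc]
  exact hlt

theorem IsGLT.side_unique (h : Γ.IsGLT) {p q : M ⊕ V} {b : N ⊕ V} (hpq : Γ.loc p = Γ.loc q)
    (hp : b ∈ Γ.Side p) (hq : b ∈ Γ.Side q) : p = q := by
  refine h.inj p q hpq ?_
  refine h.isTree.closer_neighbor_unique (h.adj p).symm ?_ hp ?_
  · rw [hpq]; exact (h.adj q).symm
  · rw [hpq]; exact hq

theorem eq_inr_of_loc_eq {p : M ⊕ V} {v : V} (hp : Γ.loc p = Sum.inr v) :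
    p = Sum.inr v := by
  cases p with
  | inl m => simp at hp
  | inr w => simpa using hp

theorem IsGLT.mem_side_iff_of_opp_inl (h : Γ.IsGLT) {p : M ⊕ V} {m : M}
    (hp : Γ.opp p = Sum.inl m) {b : N ⊕ V} (hb : b ≠ Sum.inl (Γ.node m)) :
    b ∈ Γ.Side p ↔ ∃ m', Γ.node m' = Γ.node m ∧ m' ≠ m ∧ b ∈ Γ.Side (Sum.inl m') := by
  have e : Γ.opp (Sum.inl m) = p := opp_eq_comm hp
  have key := h.mem_side_opp (Sum.inl m) b
  rw [e] at key
  rw [key]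
  -- Exactly one marker vertex of the node leads to `b`; `b` is beyond `p` iff that marker vertex is
  -- not `m`.
  obtain ⟨q, hq, hbq⟩ := h.exists_mem_side hb.symm
  obtain ⟨m', rfl⟩ : ∃ m', q = Sum.inl m' := by
    cases q with
    | inl m' => exact ⟨m', rfl⟩
    | inr w => simp at hq
  constructor
  · intro hm
    refine ⟨m', by simpa using hq, ?_, hbq⟩
    rintro rfl
    exact hm hbq
  · rintro ⟨m'', hn, hne, hb'⟩ hm
    exact hne (Sum.inl_injective (h.side_unique (by simp [hn]) hb' hm))

/-- Strictness comes from the node of `m`, which is beyond `p` but not beyond its own marker vertex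
`m'`. This is the decreasing measure behind `IsGLT.induction`. -/
theorem IsGLT.side_ssubset (h : Γ.IsGLT) {p : M ⊕ V} {m m' : M} (hp : Γ.opp p = Sum.inl m)
    (hn : Γ.node m' = Γ.node m) (hne : m' ≠ m) : Γ.Side (Sum.inl m') ⊂ Γ.Side p := by
  have hnot : ∀ b ∈ Γ.Side (Sum.inl m'), b ≠ Sum.inl (Γ.node m) := by
    rintro b hb rfl
    rw [← hn] at hb
    exact loc_notMem_side (Sum.inl m') hb
  refine ⟨fun b hb => (h.mem_side_iff_of_opp_inl hp (hnot b hb)).2 ⟨m', hn, hne, hb⟩, fun hsub => ?_⟩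
  have : Sum.inl (Γ.node m) ∈ Γ.Side p := by
    have := h.loc_opp_mem_side p
    rwa [hp] at this
  exact hnot _ (hsub this) rfl

/-- Induction on the part of the tree lying beyond an extremity. -/
theorem IsGLT.induction [Finite V] [Finite N] (h : Γ.IsGLT) {motive : M ⊕ V → Prop}
    (leaf : ∀ p v, Γ.opp p = Sum.inr v → motive p)
    (step : ∀ p m, Γ.opp p = Sum.inl m →
      (∀ m', Γ.node m' = Γ.node m → m' ≠ m → motive (Sum.inl m')) → motive p)
    (p : M ⊕ V) : motive p := by
  induction hk : (Γ.Side p).ncard using Nat.strong_induction_on generalizing p with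
  | _ k ih =>
    cases hp : Γ.opp p with
    | inr v => exact leaf p v hp
    | inl m =>
      refine step p m hp fun m' hn hne => ih _ ?_ _ rfl
      rw [← hk]
      exact Set.ncard_lt_ncard (h.side_ssubset hp hn hne) (Set.toFinite _)

/-! ### The leaves beyond an extremity -/

/-- Paths in a tree are geodesics, so the path to `loc p` uses the edge exactly when the far end is
closer. From here on, paths are replaced by distances. -/
theorem IsGLT.mem_L_iff_mem_side (h : Γ.IsGLT) (p : M ⊕ V) (l : V) :
    l ∈ Γ.L p ↔ Sum.inr l ∈ Γ.Side p := by
  have hd := h.isTree.dist_eq_dist_add_one_of_adj (Sum.inr l) (h.adj p)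
  have hlen : ∀ {a b : N ⊕ V} (w : Γ.tree.Walk a b), w.IsPath → w.length = Γ.tree.dist a b := by
    intro a b w hw
    obtain ⟨w', hw'⟩ := h.isTree.connected.exists_walk_length_eq_dist a b
    rw [← hw', (h.isTree.existsUnique_path a b).unique hw (w'.isPath_of_length_eq_dist hw')]
  constructor
  · rintro ⟨w, hw, he⟩
    have hs : Γ.loc (Γ.opp p) ∈ w.support := w.snd_mem_support_of_mem_edges he
    classical
    have h1 := congrArg SimpleGraph.Walk.length (w.take_spec hs)
    rw [SimpleGraph.Walk.length_append] at h1
    have h2 := hlen w hw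
    have h3 := SimpleGraph.dist_le (w.takeUntil _ hs)
    simp only [Side, Set.mem_ofPred_eq]
    omega
  · intro hl
    simp only [Side, Set.mem_ofPred_eq] at hl
    obtain ⟨w, hw⟩ := h.isTree.connected.exists_walk_length_eq_dist (Sum.inr l) (Γ.loc (Γ.opp p))
    refine ⟨w.concat (h.adj p).symm, SimpleGraph.Walk.isPath_of_length_eq_dist _ ?_, ?_⟩
    · rw [SimpleGraph.Walk.length_concat, hw]
      omega
    · rw [SimpleGraph.Walk.edges_concat]
      simp [Sym2.eq_swap]

theorem IsGLT.mem_L_opp (h : Γ.IsGLT) (p : M ⊕ V) (l : V) : l ∈ Γ.L (Γ.opp p) ↔ l ∉ Γ.L p := by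
  rw [h.mem_L_iff_mem_side, h.mem_L_iff_mem_side, h.mem_side_opp]

theorem IsGLT.L_unique (h : Γ.IsGLT) {m m' : M} {l : V} (hn : Γ.node m = Γ.node m')
    (hm : l ∈ Γ.L (Sum.inl m)) (hm' : l ∈ Γ.L (Sum.inl m')) : m = m' := by
  rw [h.mem_L_iff_mem_side] at hm hm'
  exact Sum.inl_injective (h.side_unique (by simp [hn]) hm hm')

theorem IsGLT.mem_L_of_opp_inl (h : Γ.IsGLT) {p : M ⊕ V} {m : M} (hp : Γ.opp p = Sum.inl m)
    (l : V) : l ∈ Γ.L p ↔ ∃ m', Γ.node m' = Γ.node m ∧ m' ≠ m ∧ l ∈ Γ.L (Sum.inl m') := by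
  simp only [h.mem_L_iff_mem_side]
  exact h.mem_side_iff_of_opp_inl hp (by simp)

theorem IsGLT.mem_L_of_opp_inr (h : Γ.IsGLT) {p : M ⊕ V} {v : V} (hp : Γ.opp p = Sum.inr v)
    (l : V) : l ∈ Γ.L p ↔ l = v := by
  have key := h.mem_L_opp (Sum.inr v) l
  rw [opp_eq_comm hp, h.mem_L_iff_mem_side (Sum.inr v)] at key
  rw [key]
  constructor
  · intro hl
    by_contra hne
    obtain ⟨q, hq, hb⟩ := h.exists_mem_side (a := Sum.inr v) (b := Sum.inr l)
      (fun e => hne (Sum.inr_injective e).symm)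
    rw [eq_inr_of_loc_eq hq] at hb
    exact hl hb
  · rintro rfl
    exact loc_notMem_side (Sum.inr l)

theorem IsGLT.exists_mem_L (h : Γ.IsGLT) (u : N) (l : V) :
    ∃ m, Γ.node m = u ∧ l ∈ Γ.L (Sum.inl m) := by
  obtain ⟨q, hq, hb⟩ := h.exists_mem_side (a := Sum.inl u) (b := Sum.inr l) (by simp)
  cases q with
  | inl m => exact ⟨m, by simpa using hq, (h.mem_L_iff_mem_side _ _).2 hb⟩
  | inr w => simp at hq

/-! ### Accessible leaves -/

theorem altSeq_true_iff_of_opp_inr {p : M ⊕ V} {v l : V} (hp : Γ.opp p = Sum.inr v)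
    (hne : p ≠ Sum.inr l) : Γ.AltSeq true p (Sum.inr l) ↔ l = v := by
  constructor
  · intro h
    cases h with
    | nil => exact absurd rfl hne
    | treeEdge h =>
      rw [hp] at h
      cases h
      rfl
  · rintro rfl
    refine AltSeq.treeEdge ?_
    rw [hp]
    exact AltSeq.nil _ _

theorem altSeq_true_iff_of_opp_inl {p : M ⊕ V} {m : M} {l : V} (hp : Γ.opp p = Sum.inl m)
    (hne : p ≠ Sum.inr l) : Γ.AltSeq true p (Sum.inr l) ↔
      ∃ m', Γ.labels.Adj m m' ∧ Γ.AltSeq true (Sum.inl m') (Sum.inr l) := by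
  constructor
  · intro h
    cases h with
    | nil => exact absurd rfl hne
    | treeEdge h =>
      rw [hp] at h
      cases h with
      | labelEdge hadj h => exact ⟨_, hadj, h⟩
  · rintro ⟨m', hadj, h⟩
    refine AltSeq.treeEdge ?_
    rw [hp]
    exact AltSeq.labelEdge hadj h

theorem IsGLT.mem_A_of_opp_inr (h : Γ.IsGLT) {p : M ⊕ V} {v : V} (hp : Γ.opp p = Sum.inr v)
    (l : V) : l ∈ Γ.A p ↔ l = v := by
  constructor
  · rintro ⟨hl, -⟩
    exact (h.mem_L_of_opp_inr hp l).1 hl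
  · rintro rfl
    refine ⟨(h.mem_L_of_opp_inr hp l).2 rfl, true, AltSeq.treeEdge ?_⟩
    rw [hp]
    exact AltSeq.nil _ _

/-- An alternating sequence cannot turn back: having entered a node at `m`, it must follow a
label-edge to some `m' ≠ m` before leaving. -/
theorem IsGLT.mem_L_of_altSeq [Finite V] [Finite N] (h : Γ.IsGLT) (p : M ⊕ V) :
    ∀ l, p ≠ Sum.inr l → Γ.AltSeq true p (Sum.inr l) → l ∈ Γ.L p := by
  induction p using h.induction with
  | leaf p v hp =>
    intro l hne hl
    rw [h.mem_L_of_opp_inr hp]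
    exact (altSeq_true_iff_of_opp_inr hp hne).1 hl
  | step p m hp ih =>
    intro l hne hl
    obtain ⟨m', hadj, hl'⟩ := (altSeq_true_iff_of_opp_inl hp hne).1 hl
    have hn := h.node_eq _ _ hadj
    exact (h.mem_L_of_opp_inl hp l).2 ⟨m', hn.symm, hadj.ne', ih m' hn.symm hadj.ne' l (by simp) hl'⟩

theorem IsGLT.notMem_L_self (h : Γ.IsGLT) (l : V) : l ∉ Γ.L (Sum.inr l) := by
  rw [h.mem_L_iff_mem_side]
  exact loc_notMem_side (Sum.inr l)

/-- A sequence from `p` that begins with a label-edge leaves the node at another marker vertex and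
ends beyond that one, hence outside `L p`. Only sequences beginning with a tree-edge matter. -/
theorem IsGLT.mem_A_iff [Finite V] [Finite N] (h : Γ.IsGLT) (p : M ⊕ V) (l : V) :
    l ∈ Γ.A p ↔ p ≠ Sum.inr l ∧ Γ.AltSeq true p (Sum.inr l) := by
  constructor
  · rintro ⟨hl, b, hb⟩
    have hne : p ≠ Sum.inr l := by
      rintro rfl
      exact h.notMem_L_self l hl
    refine ⟨hne, ?_⟩
    cases b with
    | true => exact hb
    | false =>
      cases hb with
      | nil => exact absurd rfl hne
      | labelEdge hadj hb =>
        exact absurd (h.L_unique (h.node_eq _ _ hadj) hl (h.mem_L_of_altSeq _ l (by simp) hb))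
          hadj.ne
  · rintro ⟨hne, hl⟩
    exact ⟨h.mem_L_of_altSeq p l hne hl, true, hl⟩

/-- The recursion for accessible leaves, on which all later computations of accessibility rest. -/
theorem IsGLT.mem_A_of_opp_inl [Finite V] [Finite N] (h : Γ.IsGLT) {p : M ⊕ V} {m : M}
    (hp : Γ.opp p = Sum.inl m) (l : V) :
    l ∈ Γ.A p ↔ ∃ m', Γ.labels.Adj m m' ∧ l ∈ Γ.A (Sum.inl m') := by
  constructor
  · intro hl
    obtain ⟨hne, hl⟩ := (h.mem_A_iff p l).1 hl
    obtain ⟨m', hadj, hl'⟩ := (altSeq_true_iff_of_opp_inl hp hne).1 hl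
    exact ⟨m', hadj, (h.mem_A_iff _ l).2 ⟨by simp, hl'⟩⟩
  · rintro ⟨m', hadj, hl⟩
    have hn := h.node_eq _ _ hadj
    have hL : l ∈ Γ.L p := (h.mem_L_of_opp_inl hp l).2 ⟨m', hn.symm, hadj.ne', hl.1⟩
    have hne : p ≠ Sum.inr l := by
      rintro rfl
      exact h.notMem_L_self l hL
    exact (h.mem_A_iff p l).2 ⟨hne, (altSeq_true_iff_of_opp_inl hp hne).2
      ⟨m', hadj, ((h.mem_A_iff _ l).1 hl).2⟩⟩

theorem IsGLT.accessibilityGraph_adj [Finite V] [Finite N] (h : Γ.IsGLT) (v w : V) :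
    Γ.accessibilityGraph.Adj v w ↔ w ∈ Γ.A (Sum.inr v) := by
  rw [h.mem_A_iff]
  constructor
  · rintro ⟨hne, b, hb⟩
    refine ⟨fun e => hne (Sum.inr_injective e), ?_⟩
    cases b with
    | true => exact hb
    | false =>
      cases hb
      exact absurd rfl hne
  · rintro ⟨hne, hb⟩
    exact ⟨fun e => hne (congrArg _ e), true, hb⟩

end PreGLT

namespace PreGLT

variable {V N M : Type*} {Γ : PreGLT V N M}

/-! ### Recognising graph-labelled trees by counting -/

theorem card_dart {W : Type*} [Finite W] (T : SimpleGraph W) :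
    Nat.card T.Dart = 2 * Nat.card T.edgeSet := by
  classical
  have := Fintype.ofFinite W
  rw [Nat.card_eq_fintype_card, T.dart_card_eq_twice_card_edges, Nat.card_eq_fintype_card,
    SimpleGraph.edgeFinset_card]

/-- Extremities are in bijection with the darts of the tree, and a tree has one edge fewer than
vertices. -/
theorem IsGLT.card_extremities [Finite V] [Finite N] (h : Γ.IsGLT) :
    Nat.card (M ⊕ V) + 2 = 2 * Nat.card (N ⊕ V) := by
  have e : Nat.card (M ⊕ V) = Nat.card Γ.tree.Dart := by
    refine Nat.card_congr (Equiv.ofBijective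
      (fun p => ⟨(Γ.loc p, Γ.loc (Γ.opp p)), h.adj p⟩) ⟨fun p q hpq => ?_, ?_⟩)
    · simp only [SimpleGraph.Dart.mk.injEq, Prod.mk.injEq] at hpq
      exact h.inj p q hpq.1 hpq.2
    · rintro ⟨⟨a, b⟩, hne, p, hp, hp'⟩
      exact ⟨p, SimpleGraph.Dart.ext _ _ (Prod.ext hp hp')⟩
  rw [e, card_dart, ← (SimpleGraph.isTree_iff_connected_and_card.1 h.isTree).2]
  omega

/-- A connected tree of nodes and leaves with few enough extremities is a graph-labelled tree. -/
theorem isGLT_of_connected [Finite V] [Finite N] [Finite M]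
    (node_eq : ∀ a b, Γ.labels.Adj a b → Γ.node a = Γ.node b) (hconn : Γ.tree.Connected)
    (hcard : Nat.card (M ⊕ V) + 2 ≤ 2 * Nat.card (N ⊕ V))
    (three_le : ∀ u, 3 ≤ (Γ.markers u).ncard) : Γ.IsGLT := by
  have hle := hconn.card_vert_le_card_edgeSet_add_one
  have hd := card_dart Γ.tree
  have hex : ∀ d : Γ.tree.Dart, ∃ p, Γ.loc p = d.fst ∧ Γ.loc (Γ.opp p) = d.snd := fun d => d.adj.2
  choose f hf₁ hf₂ using hex
  have hinj : Function.Injective f := by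
    intro d d' hdd
    refine SimpleGraph.Dart.ext _ _ (Prod.ext ?_ ?_)
    · rw [← hf₁, ← hf₁, hdd]
    · rw [← hf₂, ← hf₂, hdd]
  have hfin : Finite Γ.tree.Dart := Finite.of_injective f hinj
  have hcard' := Nat.card_le_card_of_injective f hinj
  -- Connectedness gives at least as many darts as `hcard` allows extremities, so the injection `f`
  -- is onto. This rules out loops and parallel tree-edges and also forces the edge count of a tree.
  have hbij : Function.Bijective f :=
    (Nat.bijective_iff_injective_and_card f).2 ⟨hinj, by omega⟩
  refine ⟨node_eq, fun p => ?_, fun p q hpq hpq' => ?_, ?_, three_le⟩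
  · obtain ⟨d, rfl⟩ := hbij.2 p
    rw [hf₁, hf₂]
    exact d.fst_ne_snd
  · obtain ⟨d, rfl⟩ := hbij.2 p
    obtain ⟨d', rfl⟩ := hbij.2 q
    rw [hf₁, hf₁] at hpq
    rw [hf₂, hf₂] at hpq'
    exact congrArg f (SimpleGraph.Dart.ext _ _ (Prod.ext hpq hpq'))
  · refine SimpleGraph.isTree_iff_connected_and_card.2 ⟨hconn, ?_⟩
    omega

/-- Stated without `loc_ne`, so that it applies before the object is known to be a graph-labelled
tree. -/
theorem reachable_opp (p : M ⊕ V) : Γ.tree.Reachable (Γ.loc p) (Γ.loc (Γ.opp p)) := by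
  by_cases h : Γ.loc p = Γ.loc (Γ.opp p)
  · rw [h]
  · exact SimpleGraph.Adj.reachable ⟨h, p, rfl, rfl⟩

theorem reachable_of_opp {p q : M ⊕ V} {a b : N ⊕ V} (hpq : Γ.opp p = q) (ha : Γ.loc p = a)
    (hb : Γ.loc q = b) : Γ.tree.Reachable a b := by
  rw [← ha, ← hb, ← hpq]
  exact reachable_opp p

/-- Asking only for reachability, rather than a homomorphism, lets an edge be stretched into a path,
as happens in subdivisions and node-splits. -/
theorem tree_connected_of_map {V' N' M' : Type*} {Γ' : PreGLT V' N' M'}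
    (hconn : Γ.tree.Connected) (f : N ⊕ V → N' ⊕ V')
    (hf : ∀ p, Γ'.tree.Reachable (f (Γ.loc p)) (f (Γ.loc (Γ.opp p))))
    (hsurj : ∀ b, ∃ a, Γ'.tree.Reachable b (f a)) : Γ'.tree.Connected := by
  have key : ∀ a a', Γ'.tree.Reachable (f a) (f a') := by
    intro a a'
    obtain ⟨w⟩ := hconn a a'
    induction w with
    | nil => exact SimpleGraph.Reachable.refl _
    | cons hadj _ ih =>
      obtain ⟨-, p, rfl, rfl⟩ := hadj
      exact (hf p).trans ih
  have : Nonempty (N' ⊕ V') := hconn.nonempty.map f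
  refine SimpleGraph.Connected.mk fun b b' => ?_
  obtain ⟨a, ha⟩ := hsurj b
  obtain ⟨a', ha'⟩ := hsurj b'
  exact ha.trans ((key a a').trans ha'.symm)

theorem ncard_le_of_injective_image {α β : Type*} [Finite β] {s : Set α} {t : Set β} (f : α → β)
    (hf : Function.Injective f) (h : ∀ a ∈ s, f a ∈ t) : s.ncard ≤ t.ncard :=
  Set.ncard_le_ncard_of_injOn f h hf.injOn (Set.toFinite t)

/-! ### Adding a marker vertex -/

section AddMarker

variable (u : N) (Q : Set M)

@[simp] theorem addMarker_node_some (m : M) : (Γ.addMarker u Q).node (some m) = Γ.node m := rfl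

@[simp] theorem addMarker_labels_some_some (m m' : M) :
    (Γ.addMarker u Q).labels.Adj (some m) (some m') ↔ Γ.labels.Adj m m' := Iff.rfl

@[simp] theorem addMarker_labels_some_none (m : M) :
    (Γ.addMarker u Q).labels.Adj (some m) none ↔ m ∈ Q := Iff.rfl

@[simp] theorem addMarker_labels_none_some (m : M) :
    (Γ.addMarker u Q).labels.Adj none (some m) ↔ m ∈ Q := Iff.rfl

@[simp] theorem addMarker_opp_none :
    (Γ.addMarker u Q).opp (Sum.inl none) = Sum.inr none := rfl

@[simp] theorem addMarker_opp_leaf :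
    (Γ.addMarker u Q).opp (Sum.inr none) = Sum.inl none := rfl

@[simp] theorem addMarker_opp_some (p : M ⊕ V) :
    (Γ.addMarker u Q).opp (Sum.map some some p) = Sum.map some some (Γ.opp p) := by
  cases p <;> rfl

theorem addMarker_loc_some (p : M ⊕ V) :
    (Γ.addMarker u Q).loc (Sum.map some some p) = Sum.map id some (Γ.loc p) := by
  cases p <;> rfl

variable {u Q}

theorem IsGLT.addMarker [Finite V] [Finite N] [Finite M] (h : Γ.IsGLT)
    (hQ : ∀ m ∈ Q, Γ.node m = u) : (Γ.addMarker u Q).IsGLT := by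
  refine isGLT_of_connected ?_ ?_ ?_ ?_
  · rintro (_ | a) (_ | b) hab
    · rfl
    · exact (hQ b hab).symm
    · exact hQ a hab
    · exact h.node_eq a b hab
  · refine tree_connected_of_map h.isTree.connected (Sum.map id some) (fun p => ?_) ?_
    · exact reachable_of_opp (addMarker_opp_some u Q p) (addMarker_loc_some u Q p)
        (addMarker_loc_some u Q _)
    · rintro (w | _ | v)
      · exact ⟨Sum.inl w, SimpleGraph.Reachable.refl _⟩
      · exact ⟨Sum.inl u, reachable_of_opp (addMarker_opp_leaf u Q) rfl rfl⟩
      · exact ⟨Sum.inr v, SimpleGraph.Reachable.refl _⟩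
  -- One new marker vertex and one new leaf are two extremities, matching the one new tree-vertex
  -- counted twice.
  · have := h.card_extremities
    simp only [Nat.card_sum, Finite.card_option] at *
    omega
  · intro w
    exact (h.three_le w).trans
      (ncard_le_of_injective_image some (Option.some_injective M) fun m hm => hm)

end AddMarker

/-! ### Node-splits -/

/-- `(A, B)` is a split of the label of `u`, in terms of the marker vertices of `Γ`. -/
structure IsNodeSplit (Γ : PreGLT V N M) (u : N) (A B : Set M) : Prop where
  mem_or_mem : ∀ m, m ∈ A ∨ m ∈ B ↔ Γ.node m = u
  notMem : ∀ m ∈ A, m ∉ B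
  nontrivial_left : A.Nontrivial
  nontrivial_right : B.Nontrivial
  adj : ∀ a ∈ A, ∀ b ∈ B, a ∈ setNeighbors Γ.labels B → b ∈ setNeighbors Γ.labels A →
    Γ.labels.Adj a b

section NodeSplit

variable {u : N} {A B : Set M}

theorem IsNodeSplit.isSplit (h : Γ.IsNodeSplit u A B) :
    IsSplit (Γ.label u) (Subtype.val ⁻¹' A) (Subtype.val ⁻¹' B) := by
  have hnt : ∀ {s : Set M}, (∀ m ∈ s, Γ.node m = u) → s.Nontrivial →
      (Subtype.val ⁻¹' s : Set (Γ.markers u)).Nontrivial := by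
    rintro s hs ⟨a, ha, b, hb, hab⟩
    exact ⟨⟨a, hs a ha⟩, ha, ⟨b, hs b hb⟩, hb, fun e => hab (congrArg Subtype.val e)⟩
  refine ⟨?_, hnt (fun m hm => (h.mem_or_mem m).1 (Or.inl hm)) h.nontrivial_left,
    hnt (fun m hm => (h.mem_or_mem m).1 (Or.inr hm)) h.nontrivial_right, ?_⟩
  · have e : (Subtype.val ⁻¹' B : Set (Γ.markers u)) = (Subtype.val ⁻¹' A)ᶜ := by
      ext m
      exact ⟨fun hB hA => h.notMem _ hA hB, fun hA => ((h.mem_or_mem _).2 m.2).resolve_left hA⟩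
    rw [e]
    exact isCompl_compl
  · rintro a ⟨ha, b', hb', hadj⟩ b ⟨hb, a', ha', hadj'⟩
    have haA : a.1 ∈ A := ((h.mem_or_mem a.1).2 a.2).resolve_right ha
    have hbB : b.1 ∈ B := ((h.mem_or_mem b.1).2 b.2).resolve_left hb
    exact h.adj _ haA _ hbB ⟨ha, b'.1, hb', hadj⟩ ⟨hb, a'.1, ha', hadj'⟩

variable (Γ u A B)

theorem nodeSplit_node_of_mem {m : M} (hm : m ∈ B) :
    (Γ.nodeSplit u A B).node (Sum.inl m) = none := if_pos hm

theorem nodeSplit_node_of_notMem {m : M} (hm : m ∉ B) :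
    (Γ.nodeSplit u A B).node (Sum.inl m) = some (Γ.node m) := if_neg hm

@[simp] theorem nodeSplit_node_true :
    (Γ.nodeSplit u A B).node (Sum.inr true) = some u := rfl

@[simp] theorem nodeSplit_node_false :
    (Γ.nodeSplit u A B).node (Sum.inr false) = none := rfl

theorem nodeSplit_labels_inl_inl (a b : M) :
    (Γ.nodeSplit u A B).labels.Adj (Sum.inl a) (Sum.inl b) ↔
      Γ.labels.Adj a b ∧ ¬ (a ∈ A ∧ b ∈ B) ∧ ¬ (a ∈ B ∧ b ∈ A) := Iff.rfl

@[simp] theorem nodeSplit_labels_inl_false (a : M) :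
    (Γ.nodeSplit u A B).labels.Adj (Sum.inl a) (Sum.inr false) ↔
      a ∈ B ∩ setNeighbors Γ.labels A := Iff.rfl

@[simp] theorem nodeSplit_labels_false_inl (a : M) :
    (Γ.nodeSplit u A B).labels.Adj (Sum.inr false) (Sum.inl a) ↔
      a ∈ B ∩ setNeighbors Γ.labels A := Iff.rfl

@[simp] theorem nodeSplit_labels_inr_inr (i j : Bool) :
    ¬ (Γ.nodeSplit u A B).labels.Adj (Sum.inr i) (Sum.inr j) := by
  cases i <;> cases j <;> exact id

@[simp] theorem nodeSplit_opp_old (p : M ⊕ V) :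
    (Γ.nodeSplit u A B).opp (Sum.map Sum.inl id p) = Sum.map Sum.inl id (Γ.opp p) := by
  cases p <;> rfl

@[simp] theorem nodeSplit_opp_new (i : Bool) :
    (Γ.nodeSplit u A B).opp (Sum.inl (Sum.inr i)) = Sum.inl (Sum.inr (!i)) := by
  cases i <;> rfl

variable {Γ u A B}

theorem IsNodeSplit.node_eq_of_left (h : Γ.IsNodeSplit u A B) {m : M} (hm : m ∈ A) :
    Γ.node m = u := (h.mem_or_mem m).1 (Or.inl hm)

theorem IsNodeSplit.node_eq_of_right (h : Γ.IsNodeSplit u A B) {m : M} (hm : m ∈ B) :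
    Γ.node m = u := (h.mem_or_mem m).1 (Or.inr hm)

theorem IsNodeSplit.mem_left_iff (h : Γ.IsNodeSplit u A B) {m : M} (hm : Γ.node m = u) :
    m ∈ A ↔ m ∉ B :=
  ⟨h.notMem m, fun hB => ((h.mem_or_mem m).2 hm).resolve_right hB⟩

theorem IsGLT.nodeSplit [Finite V] [Finite N] [Finite M] (h : Γ.IsGLT)
    (hs : Γ.IsNodeSplit u A B) : (Γ.nodeSplit u A B).IsGLT := by
  have hq : (Γ.nodeSplit u A B).tree.Reachable (Sum.inl none) (Sum.inl (some u)) :=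
    reachable_of_opp (nodeSplit_opp_new Γ u A B false) rfl rfl
  -- Marker vertices in `B` have moved from `u` to `none`, but the new tree-edge joins these two
  -- nodes.
  have hloc : ∀ p, (Γ.nodeSplit u A B).tree.Reachable (Sum.map some id (Γ.loc p))
      ((Γ.nodeSplit u A B).loc (Sum.map Sum.inl id p)) := by
    rintro (m | v)
    · by_cases hm : m ∈ B
      · have e : (Γ.nodeSplit u A B).loc (Sum.map Sum.inl id (Sum.inl m)) = Sum.inl none :=
          congrArg Sum.inl (nodeSplit_node_of_mem Γ u A B hm)
        have e' : Sum.map some id (Γ.loc (Sum.inl m : M ⊕ V)) = Sum.inl (some u) :=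
          congrArg (fun w => Sum.inl (some w)) (hs.node_eq_of_right hm)
        rw [e, e']
        exact hq.symm
      · have e : (Γ.nodeSplit u A B).loc (Sum.map Sum.inl id (Sum.inl m)) =
            Sum.inl (some (Γ.node m)) := congrArg Sum.inl (nodeSplit_node_of_notMem Γ u A B hm)
        rw [e]
        exact SimpleGraph.Reachable.refl _
    · exact SimpleGraph.Reachable.refl _
  refine isGLT_of_connected ?_ ?_ ?_ ?_
  · have hold : ∀ a b, (Γ.nodeSplit u A B).labels.Adj (Sum.inl a) (Sum.inl b) → a ∈ B → b ∈ B := by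
      rintro a b ⟨hadj, -, hn⟩ ha
      have hb : Γ.node b = u := by rw [← h.node_eq _ _ hadj, hs.node_eq_of_right ha]
      by_contra hb'
      exact hn ⟨ha, (hs.mem_left_iff hb).2 hb'⟩
    rintro (a | (_ | _)) (b | (_ | _)) hab
    · by_cases ha : a ∈ B
      · rw [nodeSplit_node_of_mem Γ u A B ha, nodeSplit_node_of_mem Γ u A B (hold a b hab ha)]
      · have hb : b ∉ B := fun hb => ha (hold b a hab.symm hb)
        rw [nodeSplit_node_of_notMem Γ u A B ha, nodeSplit_node_of_notMem Γ u A B hb,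
          h.node_eq _ _ hab.1]
    · exact nodeSplit_node_of_mem Γ u A B hab.1
    · rw [nodeSplit_node_of_notMem Γ u A B (hs.notMem a hab.1), hs.node_eq_of_left hab.1]
      rfl
    · exact (nodeSplit_node_of_mem Γ u A B hab.1).symm
    · exact hab.elim
    · exact hab.elim
    · rw [nodeSplit_node_of_notMem Γ u A B (hs.notMem b hab.1), hs.node_eq_of_left hab.1]
      rfl
    · exact hab.elim
    · exact hab.elim
  · refine tree_connected_of_map h.isTree.connected (Sum.map some id) (fun p => ?_) ?_
    · exact (hloc p).trans ((reachable_of_opp (nodeSplit_opp_old Γ u A B p) rfl rfl).trans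
        (hloc _).symm)
    · rintro ((_ | w) | v)
      · exact ⟨Sum.inl u, hq⟩
      · exact ⟨Sum.inl w, SimpleGraph.Reachable.refl _⟩
      · exact ⟨Sum.inr v, SimpleGraph.Reachable.refl _⟩
  · have := h.card_extremities
    simp only [Nat.card_sum, Finite.card_option, Nat.card_eq_fintype_card (α := Bool),
      Fintype.card_bool] at *
    omega
  -- Each half keeps at least two old marker vertices, since both sides of a split are nontrivial;
  -- the new marker vertex is the third.
  · have key : ∀ (s : Set M) (w : Option N) (i : Bool), s.Nontrivial →
        (∀ m ∈ s, (Γ.nodeSplit u A B).node (Sum.inl m) = w) →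
        (Γ.nodeSplit u A B).node (Sum.inr i) = w →
        3 ≤ ((Γ.nodeSplit u A B).markers w).ncard := by
      rintro s w i ⟨a, ha, b, hb, hab⟩ hw hi
      have h3 : ({Sum.inl a, Sum.inl b, Sum.inr i} : Set (M ⊕ Bool)).ncard = 3 :=
        Set.ncard_eq_three.2 ⟨_, _, _, by simpa using hab, by simp, by simp, rfl⟩
      rw [← h3]
      refine Set.ncard_le_ncard ?_ (Set.toFinite _)
      rintro m (rfl | rfl | rfl)
      · exact hw a ha
      · exact hw b hb
      · exact hi
    rintro (_ | w)
    · exact key B none false hs.nontrivial_right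
        (fun m hm => nodeSplit_node_of_mem Γ u A B hm) rfl
    · by_cases hw : w = u
      · subst hw
        refine key A (some w) true hs.nontrivial_left (fun m hm => ?_) rfl
        rw [nodeSplit_node_of_notMem Γ w A B (hs.notMem m hm), hs.node_eq_of_left hm]
      · refine (h.three_le w).trans (ncard_le_of_injective_image Sum.inl Sum.inl_injective ?_)
        intro m hm
        have hmB : m ∉ B := fun hB => hw (hm.symm.trans (hs.node_eq_of_right hB))
        exact (nodeSplit_node_of_notMem Γ u A B hmB).trans (congrArg some hm)

end NodeSplit

/-! ### Subdivisions -/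

section Subdivide

variable (Γ) (p : M ⊕ V) (K : SimpleGraph (Fin 3))

@[simp] theorem subdivide_node_inl (m : M) :
    (Γ.subdivide p K).node (Sum.inl m) = some (Γ.node m) := rfl

@[simp] theorem subdivide_node_inr (i : Fin 3) :
    (Γ.subdivide p K).node (Sum.inr i) = none := rfl

@[simp] theorem subdivide_labels_inr_inr (i j : Fin 3) :
    (Γ.subdivide p K).labels.Adj (Sum.inr i) (Sum.inr j) ↔ K.Adj i j := Iff.rfl

@[simp] theorem subdivide_labels_inl_inr (a : M) (i : Fin 3) :
    ¬ (Γ.subdivide p K).labels.Adj (Sum.inl a) (Sum.inr i) := fun h => by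
  simp [subdivide] at h

@[simp] theorem subdivide_labels_inr_inl (a : M) (i : Fin 3) :
    ¬ (Γ.subdivide p K).labels.Adj (Sum.inr i) (Sum.inl a) := fun h => by
  simp [subdivide] at h

@[simp] theorem subdivide_opp_zero :
    (Γ.subdivide p K).opp (Sum.inl (Sum.inr 0)) = oldExt p := rfl

@[simp] theorem subdivide_opp_one :
    (Γ.subdivide p K).opp (Sum.inl (Sum.inr 1)) = oldExt (Γ.opp p) := rfl

@[simp] theorem subdivide_opp_two :
    (Γ.subdivide p K).opp (Sum.inl (Sum.inr 2)) = Sum.inr none := rfl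

@[simp] theorem subdivide_opp_leaf :
    (Γ.subdivide p K).opp (Sum.inr none) = Sum.inl (Sum.inr 2) := rfl

theorem subdivide_opp_old (e : M ⊕ V) :
    (Γ.subdivide p K).opp (oldExt e) = Γ.subdivideOpp p e := by
  cases e <;> rfl

theorem subdivide_opp_left : (Γ.subdivide p K).opp (oldExt p) = Sum.inl (Sum.inr 0) := by
  rw [subdivide_opp_old]
  simp [subdivideOpp]

theorem subdivide_opp_right :
    (Γ.subdivide p K).opp (oldExt (Γ.opp p)) = Sum.inl (Sum.inr 1) := by
  rw [subdivide_opp_old]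
  simp [subdivideOpp, Γ.opp_ne p]

theorem subdivide_opp_of_ne {e : M ⊕ V} (h₁ : e ≠ p) (h₂ : e ≠ Γ.opp p) :
    (Γ.subdivide p K).opp (oldExt e) = oldExt (Γ.opp e) := by
  rw [subdivide_opp_old]
  exact (Γ.subdivideOpp_of_ne h₁ h₂).1

theorem subdivide_loc_old (e : M ⊕ V) :
    (Γ.subdivide p K).loc (oldExt e) = Sum.map some some (Γ.loc e) := by
  cases e <;> rfl

variable {Γ p K}

theorem IsGLT.subdivide [Finite V] [Finite N] [Finite M] (h : Γ.IsGLT) :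
    (Γ.subdivide p K).IsGLT := by
  have h0 : (Γ.subdivide p K).tree.Reachable (Sum.map some some (Γ.loc p)) (Sum.inl none) :=
    reachable_of_opp (subdivide_opp_left Γ p K) (subdivide_loc_old Γ p K p) rfl
  have h1 : (Γ.subdivide p K).tree.Reachable (Sum.map some some (Γ.loc (Γ.opp p)))
      (Sum.inl none) :=
    reachable_of_opp (subdivide_opp_right Γ p K) (subdivide_loc_old Γ p K _) rfl
  have h2 : (Γ.subdivide p K).tree.Reachable (Sum.inr none) (Sum.inl none) :=
    reachable_of_opp (subdivide_opp_leaf Γ p K) rfl rfl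
  refine isGLT_of_connected ?_ ?_ ?_ ?_
  · rintro (a | i) (b | j) hab
    · exact congrArg some (h.node_eq a b hab)
    · exact absurd hab (by simp)
    · exact absurd hab (by simp)
    · rfl
  · refine tree_connected_of_map h.isTree.connected (Sum.map some some) (fun e => ?_) ?_
    · by_cases he : e = p
      · subst he
        exact h0.trans h1.symm
      by_cases he' : e = Γ.opp p
      · subst he'
        rw [Γ.opp_opp]
        exact h1.trans h0.symm
      · exact reachable_of_opp (subdivide_opp_of_ne Γ p K he he') (subdivide_loc_old Γ p K e)
          (subdivide_loc_old Γ p K _)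
    · rintro ((_ | w) | (_ | v))
      · exact ⟨_, h0.symm⟩
      · exact ⟨Sum.inl w, SimpleGraph.Reachable.refl _⟩
      · exact ⟨_, h2.trans h0.symm⟩
      · exact ⟨Sum.inr v, SimpleGraph.Reachable.refl _⟩
  -- Three marker vertices and a leaf are four extremities, against one new node and one new leaf.
  · have := h.card_extremities
    simp only [Nat.card_sum, Finite.card_option, Nat.card_eq_fintype_card (α := Fin 3),
      Fintype.card_fin] at *
    omega
  · rintro (_ | w)
    · have h3 : ({Sum.inr 0, Sum.inr 1, Sum.inr 2} : Set (M ⊕ Fin 3)).ncard = 3 :=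
        Set.ncard_eq_three.2 ⟨_, _, _, by simp, by simp, by simp, rfl⟩
      refine h3.ge.trans (Set.ncard_le_ncard ?_ (Set.toFinite _))
      rintro m (rfl | rfl | rfl) <;> rfl
    · exact (h.three_le w).trans
        (ncard_le_of_injective_image Sum.inl Sum.inl_injective fun m hm => congrArg some hm)

end Subdivide

end PreGLT

namespace PreGLT

variable {V N M : Type*} {Γ : PreGLT V N M} {S : Set V}

/-! ### States -/

theorem isPerfect_iff {p : M ⊕ V} :
    Γ.IsPerfect S p ↔ ∀ l ∈ Γ.L p, l ∈ S ↔ l ∈ Γ.A p := by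
  refine Set.ext_iff.trans ⟨fun h l hl => ?_, fun h l => ?_⟩
  · exact ⟨fun hS => (h l).1 ⟨hS, hl⟩, fun hA => ((h l).2 hA).1⟩
  · exact ⟨fun hl => (h l hl.2).1 hl.1, fun hA => ⟨(h l hA.1).2 hA, hA.1⟩⟩

theorem isEmptyState_iff {p : M ⊕ V} : Γ.IsEmptyState S p ↔ ∀ l ∈ Γ.L p, l ∉ S := by
  refine Set.eq_empty_iff_forall_notMem.trans ⟨fun h l hl hS => h l ⟨hS, hl⟩, fun h l hl => ?_⟩
  exact h l hl.2 hl.1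

theorem IsGLT.isEmptyState_iff_of_opp_inl (h : Γ.IsGLT) {p : M ⊕ V} {m : M}
    (hp : Γ.opp p = Sum.inl m) :
    Γ.IsEmptyState S p ↔
      ∀ m', Γ.node m' = Γ.node m → m' ≠ m → Γ.IsEmptyState S (Sum.inl m') := by
  simp only [isEmptyState_iff, h.mem_L_of_opp_inl hp]
  exact ⟨fun hl m' hn hne l hl' => hl l ⟨m', hn, hne, hl'⟩,
    fun hall l ⟨m', hn, hne, hl'⟩ => hall m' hn hne l hl'⟩

/-- The sets `L m` for the marker vertices of `u` cover all leaves; empty ones contribute nothing to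
`S` and a perfect `m` contributes `A m`. This is why joining the new marker vertex to `P u` gives
`x` the neighbourhood `S`. -/
theorem IsGLT.mem_iff_exists_perfect (h : Γ.IsGLT) {u : N}
    (hu : ∀ m, Γ.node m = u → Γ.IsPerfect S (Sum.inl m) ∨ Γ.IsEmptyState S (Sum.inl m)) (l : V) :
    l ∈ S ↔ ∃ m ∈ Γ.P S u, l ∈ Γ.A (Sum.inl m) := by
  constructor
  · intro hS
    obtain ⟨m, hm, hl⟩ := h.exists_mem_L u l
    have hP : Γ.IsPerfect S (Sum.inl m) :=
      (hu m hm).resolve_right fun he => isEmptyState_iff.1 he l hl hS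
    exact ⟨m, ⟨hm, hP⟩, (isPerfect_iff.1 hP l hl).1 hS⟩
  · rintro ⟨m, ⟨-, hP⟩, hl⟩
    exact (isPerfect_iff.1 hP l hl.1).2 hl

theorem IsGLT.mem_L_or (h : Γ.IsGLT) (p : M ⊕ V) (l : V) : l ∈ Γ.L p ∨ l ∈ Γ.L (Γ.opp p) := by
  rw [h.mem_L_opp]
  exact em _

section

variable [Finite V] [Finite N]

/-- The disjoint sets `L m'` make up `L p`, and `A p` meets `L m'` in `A m'` or in nothing according
to whether `m` and `m'` are adjacent. Perfection can thus be tested one marker vertex at a time. -/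
theorem IsGLT.isPerfect_iff_of_opp_inl (h : Γ.IsGLT) {p : M ⊕ V} {m : M}
    (hp : Γ.opp p = Sum.inl m) :
    Γ.IsPerfect S p ↔ ∀ m', Γ.node m' = Γ.node m → m' ≠ m →
      (Γ.labels.Adj m m' → Γ.IsPerfect S (Sum.inl m')) ∧
      (¬ Γ.labels.Adj m m' → Γ.IsEmptyState S (Sum.inl m')) := by
  rw [isPerfect_iff]
  constructor
  · intro hperf m' hn hne
    have key : ∀ l ∈ Γ.L (Sum.inl m'), l ∈ S ↔ Γ.labels.Adj m m' ∧ l ∈ Γ.A (Sum.inl m') := by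
      intro l hl
      rw [hperf l ((h.mem_L_of_opp_inl hp l).2 ⟨m', hn, hne, hl⟩), h.mem_A_of_opp_inl hp]
      constructor
      · rintro ⟨m'', hadj, hA⟩
        have : m'' = m' := h.L_unique ((h.node_eq _ _ hadj).symm.trans hn.symm) hA.1 hl
        subst this
        exact ⟨hadj, hA⟩
      · rintro ⟨hadj, hA⟩
        exact ⟨m', hadj, hA⟩
    refine ⟨fun hadj => isPerfect_iff.2 fun l hl => ?_,
      fun hadj => isEmptyState_iff.2 fun l hl hS => hadj ((key l hl).1 hS).1⟩
    rw [key l hl]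
    exact and_iff_right hadj
  · intro hall l hl
    obtain ⟨m', hn, hne, hl'⟩ := (h.mem_L_of_opp_inl hp l).1 hl
    rw [h.mem_A_of_opp_inl hp]
    constructor
    · intro hS
      have hadj : Γ.labels.Adj m m' := by
        by_contra hadj
        exact isEmptyState_iff.1 ((hall m' hn hne).2 hadj) l hl' hS
      exact ⟨m', hadj, (isPerfect_iff.1 ((hall m' hn hne).1 hadj) l hl').1 hS⟩
    · rintro ⟨m'', hadj, hA⟩
      exact (isPerfect_iff.1 ((hall m'' (h.node_eq _ _ hadj).symm hadj.ne').1 hadj) l hA.1).2 hA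

/-- Without isolated vertices in labels, an alternating sequence can always be prolonged until it
hits a leaf. Consequently perfect and empty exclude each other. -/
theorem IsGLT.A_nonempty (h : Γ.IsGLT) (hadj : ∀ m, ∃ m', Γ.labels.Adj m m') (p : M ⊕ V) :
    (Γ.A p).Nonempty := by
  induction p using h.induction with
  | leaf p v hp => exact ⟨v, (h.mem_A_of_opp_inr hp v).2 rfl⟩
  | step p m hp ih =>
    obtain ⟨m', hm'⟩ := hadj m
    obtain ⟨l, hl⟩ := ih m' (h.node_eq _ _ hm').symm hm'.ne'
    exact ⟨l, (h.mem_A_of_opp_inl hp l).2 ⟨m', hm', hl⟩⟩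

theorem IsGLT.not_isEmptyState_of_isPerfect (h : Γ.IsGLT) (hadj : ∀ m, ∃ m', Γ.labels.Adj m m')
    {p : M ⊕ V} (hp : Γ.IsPerfect S p) : ¬ Γ.IsEmptyState S p := by
  obtain ⟨l, hl⟩ := h.A_nonempty hadj p
  exact fun he => isEmptyState_iff.1 he l hl.1 ((isPerfect_iff.1 hp l hl.1).2 hl)

end

theorem accessibilityGraph_eq_addVertex {V' N' M' : Type*} [Finite V'] [Finite N']
    {Γ' : PreGLT (Option V') N' M'} (h : Γ'.IsGLT) {G : SimpleGraph V'} {S : Set V'}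
    (hold : ∀ v w, some w ∈ Γ'.A (Sum.inr (some v)) ↔ G.Adj v w)
    (hnew : ∀ w, some w ∈ Γ'.A (Sum.inr none) ↔ w ∈ S) :
    Γ'.accessibilityGraph = addVertex G S := by
  ext v w
  rcases v with _ | v <;> rcases w with _ | w
  · exact ⟨fun hv => absurd rfl hv.ne, fun hv => hv.elim⟩
  · rw [h.accessibilityGraph_adj, hnew]
    rfl
  · rw [SimpleGraph.adj_comm, h.accessibilityGraph_adj, hnew]
    rfl
  · rw [h.accessibilityGraph_adj, hold]
    rfl

section

variable [Finite V] [Finite N] [Finite M]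

/-! ### Accessibility after adding a marker vertex -/

/-- The new marker vertex leads only to the new leaf, so it opens no route between old leaves. -/
theorem IsGLT.mem_A_addMarker (h : Γ.IsGLT) {u : N} {Q : Set M} (hQ : ∀ m ∈ Q, Γ.node m = u)
    (p : M ⊕ V) (w : V) :
    some w ∈ (Γ.addMarker u Q).A (Sum.map some some p) ↔ w ∈ Γ.A p := by
  have h' := h.addMarker hQ
  induction p using h.induction with
  | leaf p v hp =>
    have hp' : (Γ.addMarker u Q).opp (Sum.map some some p) = Sum.inr (some v) := by
      rw [addMarker_opp_some, hp]
      rfl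
    rw [h.mem_A_of_opp_inr hp, h'.mem_A_of_opp_inr hp', Option.some_inj]
  | step p m hp ih =>
    have hp' : (Γ.addMarker u Q).opp (Sum.map some some p) = Sum.inl (some m) := by
      rw [addMarker_opp_some, hp]
      rfl
    rw [h.mem_A_of_opp_inl hp, h'.mem_A_of_opp_inl hp']
    constructor
    · rintro ⟨_ | m', hadj, hA⟩
      · rw [h'.mem_A_of_opp_inr (addMarker_opp_none u Q)] at hA
        exact absurd hA (by simp)
      · have hadj' : Γ.labels.Adj m m' := hadj
        exact ⟨m', hadj', (ih m' (h.node_eq _ _ hadj').symm hadj'.ne').1 hA⟩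
    · rintro ⟨m', hadj, hA⟩
      exact ⟨some m', hadj, (ih m' (h.node_eq _ _ hadj).symm hadj.ne').2 hA⟩

theorem IsGLT.accessibilityGraph_addMarker (h : Γ.IsGLT) {u : N}
    (hu : ∀ m, Γ.node m = u → Γ.IsPerfect S (Sum.inl m) ∨ Γ.IsEmptyState S (Sum.inl m)) :
    (Γ.addMarker u (Γ.P S u)).accessibilityGraph = addVertex Γ.accessibilityGraph S := by
  have hQ : ∀ m ∈ Γ.P S u, Γ.node m = u := fun m hm => hm.1
  have h' := h.addMarker hQ
  refine accessibilityGraph_eq_addVertex h' (fun v w => ?_) (fun w => ?_)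
  · rw [h.accessibilityGraph_adj]
    exact h.mem_A_addMarker hQ (Sum.inr v) w
  · rw [h'.mem_A_of_opp_inl (addMarker_opp_leaf u _), h.mem_iff_exists_perfect hu]
    constructor
    · rintro ⟨_ | m, hadj, hA⟩
      · exact absurd rfl hadj.ne
      · exact ⟨m, hadj, (h.mem_A_addMarker hQ (Sum.inl m) w).1 hA⟩
    · rintro ⟨m, hm, hA⟩
      exact ⟨some m, hm, (h.mem_A_addMarker hQ (Sum.inl m) w).2 hA⟩

/-! ### Accessibility after a subdivision -/

variable {p : M ⊕ V} {K : SimpleGraph (Fin 3)}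

/-- Here `e'` is the last extremity before the old opposite of `e`: the far marker vertex of the new
node if `e` lies on the subdivided edge, and `e` itself otherwise. Since `0` and `1` are adjacent,
old leaves are seen through the new node unchanged, and the induction can treat all tree-edges
alike. -/
theorem IsGLT.exists_opp_subdivide (h : Γ.IsGLT) (hK : K.Adj 0 1) (e : M ⊕ V) :
    ∃ e', (Γ.subdivide p K).opp e' = oldExt (Γ.opp e) ∧
      ∀ w, some w ∈ (Γ.subdivide p K).A (oldExt e) ↔ some w ∈ (Γ.subdivide p K).A e' := by
  have h' := h.subdivide (p := p) (K := K)
  have h2 : ∀ w, some w ∉ (Γ.subdivide p K).A (Sum.inl (Sum.inr 2)) := fun w hw => by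
    rw [h'.mem_A_of_opp_inr (subdivide_opp_two Γ p K)] at hw
    exact absurd hw (by simp)
  by_cases he : e = p
  · subst he
    refine ⟨Sum.inl (Sum.inr 1), subdivide_opp_one Γ e K, fun w => ?_⟩
    rw [h'.mem_A_of_opp_inl (subdivide_opp_left Γ e K)]
    refine ⟨?_, fun hA => ⟨Sum.inr 1, hK, hA⟩⟩
    rintro ⟨m | i, hadj, hA⟩
    · exact absurd hadj (by simp)
    · fin_cases i
      · exact absurd rfl hadj.ne
      · exact hA
      · exact absurd hA (h2 w)
  by_cases he' : e = Γ.opp p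
  · subst he'
    refine ⟨Sum.inl (Sum.inr 0), by rw [subdivide_opp_zero, Γ.opp_opp], fun w => ?_⟩
    rw [h'.mem_A_of_opp_inl (subdivide_opp_right Γ p K)]
    refine ⟨?_, fun hA => ⟨Sum.inr 0, hK.symm, hA⟩⟩
    rintro ⟨m | i, hadj, hA⟩
    · exact absurd hadj (by simp)
    · fin_cases i
      · exact hA
      · exact absurd rfl hadj.ne
      · exact absurd hA (h2 w)
  · exact ⟨oldExt e, subdivide_opp_of_ne Γ p K he he', fun w => Iff.rfl⟩

theorem IsGLT.mem_A_subdivide_of_opp_eq (h : Γ.IsGLT) (hK : K.Adj 0 1) (e : M ⊕ V) (w : V) :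
    ∀ e', (Γ.subdivide p K).opp e' = oldExt (Γ.opp e) →
      (some w ∈ (Γ.subdivide p K).A e' ↔ w ∈ Γ.A e) := by
  have h' := h.subdivide (p := p) (K := K)
  induction e using h.induction with
  | leaf e v he =>
    intro e' he'
    rw [he] at he'
    rw [h.mem_A_of_opp_inr he, h'.mem_A_of_opp_inr (v := some v) he', Option.some_inj]
  | step e m he ih =>
    intro e' he'
    rw [he] at he'
    rw [h.mem_A_of_opp_inl he, h'.mem_A_of_opp_inl (m := Sum.inl m) he']
    have key : ∀ m', Γ.labels.Adj m m' →
        (some w ∈ (Γ.subdivide p K).A (Sum.inl (Sum.inl m')) ↔ w ∈ Γ.A (Sum.inl m')) := by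
      intro m' hadj
      obtain ⟨e'', he'', hiff⟩ := h.exists_opp_subdivide (p := p) hK (Sum.inl m')
      exact (hiff w).trans (ih m' (h.node_eq _ _ hadj).symm hadj.ne' e'' he'')
    constructor
    · rintro ⟨m' | i, hadj, hA⟩
      · exact ⟨m', hadj, (key m' hadj).1 hA⟩
      · exact absurd hadj (by simp)
    · rintro ⟨m', hadj, hA⟩
      exact ⟨Sum.inl m', hadj, (key m' hadj).2 hA⟩

/-- The marker vertex `0` is opposite `p`, so it looks towards the location of `p`, that is, into `L
(opp p)`; hence `0` goes with `A (opp p)` and `1` with `A p`. -/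
theorem IsGLT.accessibilityGraph_subdivide (h : Γ.IsGLT) (hK : K.Adj 0 1)
    (hS : ∀ w, w ∈ S ↔ (K.Adj 2 0 ∧ w ∈ Γ.A (Γ.opp p)) ∨ (K.Adj 2 1 ∧ w ∈ Γ.A p)) :
    (Γ.subdivide p K).accessibilityGraph = addVertex Γ.accessibilityGraph S := by
  have h' := h.subdivide (p := p) (K := K)
  refine accessibilityGraph_eq_addVertex h' (fun v w => ?_) (fun w => ?_)
  · rw [h.accessibilityGraph_adj]
    obtain ⟨e', he', hiff⟩ := h.exists_opp_subdivide (p := p) hK (Sum.inr v)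
    exact (hiff w).trans (h.mem_A_subdivide_of_opp_eq hK _ w e' he')
  · have h0 : some w ∈ (Γ.subdivide p K).A (Sum.inl (Sum.inr 0)) ↔ w ∈ Γ.A (Γ.opp p) :=
      h.mem_A_subdivide_of_opp_eq hK _ w _ (by rw [subdivide_opp_zero, Γ.opp_opp])
    have h1 : some w ∈ (Γ.subdivide p K).A (Sum.inl (Sum.inr 1)) ↔ w ∈ Γ.A p :=
      h.mem_A_subdivide_of_opp_eq hK _ w _ (subdivide_opp_one Γ p K)
    rw [h'.mem_A_of_opp_inl (subdivide_opp_leaf Γ p K), hS, ← h0, ← h1]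
    constructor
    · rintro ⟨m | i, hadj, hA⟩
      · exact absurd hadj (by simp)
      · fin_cases i
        · exact Or.inl ⟨hadj, hA⟩
        · exact Or.inr ⟨hadj, hA⟩
        · exact absurd rfl hadj.ne
    · rintro (⟨hadj, hA⟩ | ⟨hadj, hA⟩)
      · exact ⟨Sum.inr 0, hadj, hA⟩
      · exact ⟨Sum.inr 1, hadj, hA⟩

theorem IsGLT.accessibilityGraph_subdivide_top (h : Γ.IsGLT) (hp : Γ.IsPPEdge S p) :
    (Γ.subdivide p ⊤).accessibilityGraph = addVertex Γ.accessibilityGraph S := by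
  refine h.accessibilityGraph_subdivide (by simp) fun w => ⟨fun hw => ?_, ?_⟩
  · rcases h.mem_L_or p w with hl | hl
    · exact Or.inr ⟨by simp, (isPerfect_iff.1 hp.1 w hl).1 hw⟩
    · exact Or.inl ⟨by simp, (isPerfect_iff.1 hp.2 w hl).1 hw⟩
  · rintro (⟨-, hA⟩ | ⟨-, hA⟩)
    · exact (isPerfect_iff.1 hp.2 w hA.1).2 hA
    · exact (isPerfect_iff.1 hp.1 w hA.1).2 hA

theorem IsGLT.accessibilityGraph_subdivide_star_one (h : Γ.IsGLT) (hp : Γ.IsPEEdge S p) :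
    (Γ.subdivide p (SimpleGraph.starGraph 1)).accessibilityGraph =
      addVertex Γ.accessibilityGraph S := by
  refine h.accessibilityGraph_subdivide (by simp) fun w => ⟨fun hw => ?_, ?_⟩
  · refine Or.inr ⟨by simp, (isPerfect_iff.1 hp.1 w ?_).1 hw⟩
    exact (h.mem_L_or p w).resolve_right fun hl => isEmptyState_iff.1 hp.2 w hl hw
  · rintro (⟨hadj, -⟩ | ⟨-, hA⟩)
    · simp at hadj
    · exact (isPerfect_iff.1 hp.1 w hA.1).2 hA

theorem IsGLT.accessibilityGraph_subdivide_star_zero (h : Γ.IsGLT)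
    (hp : Γ.IsEmptyState S p) (hp' : Γ.IsPerfect S (Γ.opp p)) :
    (Γ.subdivide p (SimpleGraph.starGraph 0)).accessibilityGraph =
      addVertex Γ.accessibilityGraph S := by
  refine h.accessibilityGraph_subdivide (by simp) fun w => ⟨fun hw => ?_, ?_⟩
  · refine Or.inl ⟨by simp, (isPerfect_iff.1 hp' w ?_).1 hw⟩
    exact (h.mem_L_or p w).resolve_left fun hl => isEmptyState_iff.1 hp w hl hw
  · rintro (⟨-, hA⟩ | ⟨hadj, -⟩)
    · exact (isPerfect_iff.1 hp' w hA.1).2 hA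
    · simp at hadj

/-! ### Accessibility after a node-split -/

variable {u : N} {A B : Set M}

/-- The extremity `q` lies at the `A` half and looks across the new edge into the `B` half. -/
theorem IsGLT.mem_L_splitExt_iff (h : Γ.IsGLT) (hs : Γ.IsNodeSplit u A B) (l : V) :
    l ∈ (Γ.nodeSplit u A B).L splitExt ↔
      ∃ b ∈ B, l ∈ (Γ.nodeSplit u A B).L (Sum.inl (Sum.inl b)) := by
  refine ((h.nodeSplit hs).mem_L_of_opp_inl (p := splitExt) (m := Sum.inr false) rfl l).trans ?_
  constructor
  · rintro ⟨b | (_ | _), hn, hne, hl⟩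
    · refine ⟨b, ?_, hl⟩
      by_contra hb
      rw [nodeSplit_node_of_notMem Γ u A B hb] at hn
      simp at hn
    · exact absurd rfl hne
    · simp at hn
  · rintro ⟨b, hb, hl⟩
    exact ⟨Sum.inl b, nodeSplit_node_of_mem Γ u A B hb, by simp, hl⟩

theorem IsGLT.mem_L_splitExt'_iff (h : Γ.IsGLT) (hs : Γ.IsNodeSplit u A B) (l : V) :
    l ∈ (Γ.nodeSplit u A B).L splitExt' ↔
      ∃ a ∈ A, l ∈ (Γ.nodeSplit u A B).L (Sum.inl (Sum.inl a)) := by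
  refine ((h.nodeSplit hs).mem_L_of_opp_inl (p := splitExt') (m := Sum.inr true) rfl l).trans ?_
  constructor
  · rintro ⟨a | (_ | _), hn, hne, hl⟩
    · refine ⟨a, ?_, hl⟩
      by_cases ha : a ∈ B
      · rw [nodeSplit_node_of_mem Γ u A B ha] at hn
        simp at hn
      · rw [nodeSplit_node_of_notMem Γ u A B ha] at hn
        exact (hs.mem_left_iff (Option.some_injective _ hn)).2 ha
    · simp at hn
    · exact absurd rfl hne
  · rintro ⟨a, ha, hl⟩
    refine ⟨Sum.inl a, ?_, by simp, hl⟩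
    rw [nodeSplit_node_of_notMem Γ u A B (hs.notMem a ha), hs.node_eq_of_left ha]
    rfl

theorem IsGLT.mem_A_splitExt_iff (h : Γ.IsGLT) (hs : Γ.IsNodeSplit u A B) (l : V) :
    l ∈ (Γ.nodeSplit u A B).A splitExt ↔
      ∃ b ∈ B ∩ setNeighbors Γ.labels A, l ∈ (Γ.nodeSplit u A B).A (Sum.inl (Sum.inl b)) := by
  refine ((h.nodeSplit hs).mem_A_of_opp_inl (p := splitExt) (m := Sum.inr false) rfl l).trans ?_
  constructor
  · rintro ⟨b | i, hadj, hl⟩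
    · exact ⟨b, hadj, hl⟩
    · exact absurd hadj (by simp)
  · rintro ⟨b, hb, hl⟩
    exact ⟨Sum.inl b, hb, hl⟩

theorem IsGLT.mem_A_splitExt'_iff (h : Γ.IsGLT) (hs : Γ.IsNodeSplit u A B) (l : V) :
    l ∈ (Γ.nodeSplit u A B).A splitExt' ↔
      ∃ a ∈ A ∩ setNeighbors Γ.labels B, l ∈ (Γ.nodeSplit u A B).A (Sum.inl (Sum.inl a)) := by
  refine ((h.nodeSplit hs).mem_A_of_opp_inl (p := splitExt') (m := Sum.inr true) rfl l).trans ?_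
  constructor
  · rintro ⟨a | i, hadj, hl⟩
    · exact ⟨a, hadj, hl⟩
    · exact absurd hadj (by simp)
  · rintro ⟨a, ha, hl⟩
    exact ⟨Sum.inl a, ha, hl⟩

theorem IsGLT.mem_L_nodeSplit (h : Γ.IsGLT) (hs : Γ.IsNodeSplit u A B) (p : M ⊕ V) (l : V) :
    l ∈ (Γ.nodeSplit u A B).L (Sum.map Sum.inl id p) ↔ l ∈ Γ.L p := by
  have h' := h.nodeSplit hs
  induction p using h.induction with
  | leaf p v hp =>
    have hp' : (Γ.nodeSplit u A B).opp (Sum.map Sum.inl id p) = Sum.inr v := by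
      rw [nodeSplit_opp_old, hp]
      rfl
    rw [h.mem_L_of_opp_inr hp, h'.mem_L_of_opp_inr hp']
  | step p m hp ih =>
    have hp' : (Γ.nodeSplit u A B).opp (Sum.map Sum.inl id p) = Sum.inl (Sum.inl m) := by
      rw [nodeSplit_opp_old, hp]
      rfl
    rw [h.mem_L_of_opp_inl hp, h'.mem_L_of_opp_inl hp']
    -- Marker vertices in the same half as `m` are reached in one step of the recursion; those in
    -- the other half are reached in two, through the new edge.
    by_cases hm : m ∈ B
    · have hmu := hs.node_eq_of_right hm
      rw [nodeSplit_node_of_mem Γ u A B hm]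
      constructor
      · rintro ⟨m' | (_ | _), hn, hne, hl⟩
        · have hm' : m' ∈ B := by
            by_contra hm'
            rw [nodeSplit_node_of_notMem Γ u A B hm'] at hn
            simp at hn
          have hn' := (hs.node_eq_of_right hm').trans hmu.symm
          have hne' : m' ≠ m := fun e => hne (congrArg _ e)
          exact ⟨m', hn', hne', (ih m' hn' hne').1 hl⟩
        · obtain ⟨a, ha, hl⟩ := (h.mem_L_splitExt'_iff hs l).1 hl
          have hn' := (hs.node_eq_of_left ha).trans hmu.symm
          have hne' : a ≠ m := fun e => hs.notMem a ha (e ▸ hm)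
          exact ⟨a, hn', hne', (ih a hn' hne').1 hl⟩
        · simp at hn
      · rintro ⟨m', hn, hne, hl⟩
        have hl' := (ih m' hn hne).2 hl
        by_cases hm' : m' ∈ B
        · exact ⟨Sum.inl m', nodeSplit_node_of_mem Γ u A B hm',
            fun e => hne (Sum.inl_injective e), hl'⟩
        · exact ⟨Sum.inr false, rfl, by simp, (h.mem_L_splitExt'_iff hs l).2
            ⟨m', (hs.mem_left_iff (hn.trans hmu)).2 hm', hl'⟩⟩
    · rw [nodeSplit_node_of_notMem Γ u A B hm]
      constructor
      · rintro ⟨m' | (_ | _), hn, hne, hl⟩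
        · have hm' : m' ∉ B := by
            intro hm'
            rw [nodeSplit_node_of_mem Γ u A B hm'] at hn
            simp at hn
          rw [nodeSplit_node_of_notMem Γ u A B hm', Option.some_inj] at hn
          have hne' : m' ≠ m := fun e => hne (congrArg _ e)
          exact ⟨m', hn, hne', (ih m' hn hne').1 hl⟩
        · simp at hn
        · obtain ⟨b, hb, hl⟩ := (h.mem_L_splitExt_iff hs l).1 hl
          have hn' := (hs.node_eq_of_right hb).trans (Option.some_injective _ hn)
          have hne' : b ≠ m := fun e => hm (e ▸ hb)
          exact ⟨b, hn', hne', (ih b hn' hne').1 hl⟩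
      · rintro ⟨m', hn, hne, hl⟩
        have hl' := (ih m' hn hne).2 hl
        by_cases hm' : m' ∈ B
        · refine ⟨Sum.inr true, ?_, by simp, (h.mem_L_splitExt_iff hs l).2 ⟨m', hm', hl'⟩⟩
          rw [← hn, hs.node_eq_of_right hm']
          rfl
        · refine ⟨Sum.inl m', ?_, fun e => hne (Sum.inl_injective e), hl'⟩
          rw [nodeSplit_node_of_notMem Γ u A B hm', hn]

/-- A label-edge between `A` and `B` is replaced by a route through `q` and `q'`. Conversely, such a
route joins two frontier vertices, which are adjacent by the split condition. -/
theorem IsGLT.mem_A_nodeSplit (h : Γ.IsGLT) (hs : Γ.IsNodeSplit u A B) (p : M ⊕ V) (l : V) :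
    l ∈ (Γ.nodeSplit u A B).A (Sum.map Sum.inl id p) ↔ l ∈ Γ.A p := by
  have h' := h.nodeSplit hs
  induction p using h.induction with
  | leaf p v hp =>
    have hp' : (Γ.nodeSplit u A B).opp (Sum.map Sum.inl id p) = Sum.inr v := by
      rw [nodeSplit_opp_old, hp]
      rfl
    rw [h.mem_A_of_opp_inr hp, h'.mem_A_of_opp_inr hp']
  | step p m hp ih =>
    have hp' : (Γ.nodeSplit u A B).opp (Sum.map Sum.inl id p) = Sum.inl (Sum.inl m) := by
      rw [nodeSplit_opp_old, hp]
      rfl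
    have ih' : ∀ m', Γ.labels.Adj m m' →
        (l ∈ (Γ.nodeSplit u A B).A (Sum.inl (Sum.inl m')) ↔ l ∈ Γ.A (Sum.inl m')) :=
      fun m' hadj => ih m' (h.node_eq _ _ hadj).symm hadj.ne'
    rw [h.mem_A_of_opp_inl hp, h'.mem_A_of_opp_inl hp']
    constructor
    · rintro ⟨m' | (_ | _), hadj, hl⟩
      · exact ⟨m', hadj.1, (ih' m' hadj.1).1 hl⟩
      · obtain ⟨a, ha, hl⟩ := (h.mem_A_splitExt'_iff hs l).1 hl
        have hadj' := (hs.adj a ha.1 m hadj.1 ha.2 hadj.2).symm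
        exact ⟨a, hadj', (ih' a hadj').1 hl⟩
      · obtain ⟨b, hb, hl⟩ := (h.mem_A_splitExt_iff hs l).1 hl
        have hadj' := hs.adj m hadj.1 b hb.1 hadj.2 hb.2
        exact ⟨b, hadj', (ih' b hadj').1 hl⟩
    · rintro ⟨m', hadj, hl⟩
      have hl' := (ih' m' hadj).2 hl
      by_cases h1 : m ∈ A ∧ m' ∈ B
      · have hb : m' ∈ B ∩ setNeighbors Γ.labels A :=
          ⟨h1.2, fun hA => hs.notMem _ hA h1.2, m, h1.1, hadj⟩
        exact ⟨Sum.inr true, ⟨h1.1, hs.notMem _ h1.1, m', h1.2, hadj.symm⟩,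
          (h.mem_A_splitExt_iff hs l).2 ⟨m', hb, hl'⟩⟩
      by_cases h2 : m ∈ B ∧ m' ∈ A
      · have ha : m' ∈ A ∩ setNeighbors Γ.labels B :=
          ⟨h2.2, hs.notMem _ h2.2, m, h2.1, hadj⟩
        exact ⟨Sum.inr false, ⟨h2.1, fun hA => hs.notMem _ hA h2.1, m', h2.2, hadj.symm⟩,
          (h.mem_A_splitExt'_iff hs l).2 ⟨m', ha, hl'⟩⟩
      · exact ⟨Sum.inl m', ⟨hadj, h1, h2⟩, hl'⟩

theorem IsGLT.accessibilityGraph_nodeSplit (h : Γ.IsGLT) (hs : Γ.IsNodeSplit u A B) :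
    (Γ.nodeSplit u A B).accessibilityGraph = Γ.accessibilityGraph := by
  ext v w
  rw [h.accessibilityGraph_adj, (h.nodeSplit hs).accessibilityGraph_adj]
  exact h.mem_A_nodeSplit hs (Sum.inr v) w

theorem IsGLT.mem_L_splitExt (h : Γ.IsGLT) (hs : Γ.IsNodeSplit u A B) (l : V) :
    l ∈ (Γ.nodeSplit u A B).L splitExt ↔ ∃ b ∈ B, l ∈ Γ.L (Sum.inl b) := by
  simp only [h.mem_L_splitExt_iff hs, ← h.mem_L_nodeSplit hs]
  rfl

theorem IsGLT.mem_L_splitExt' (h : Γ.IsGLT) (hs : Γ.IsNodeSplit u A B) (l : V) :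
    l ∈ (Γ.nodeSplit u A B).L splitExt' ↔ ∃ a ∈ A, l ∈ Γ.L (Sum.inl a) := by
  simp only [h.mem_L_splitExt'_iff hs, ← h.mem_L_nodeSplit hs]
  rfl

theorem IsGLT.mem_A_splitExt (h : Γ.IsGLT) (hs : Γ.IsNodeSplit u A B) (l : V) :
    l ∈ (Γ.nodeSplit u A B).A splitExt ↔
      ∃ b ∈ B ∩ setNeighbors Γ.labels A, l ∈ Γ.A (Sum.inl b) := by
  simp only [h.mem_A_splitExt_iff hs, ← h.mem_A_nodeSplit hs]
  rfl

theorem IsGLT.mem_A_splitExt' (h : Γ.IsGLT) (hs : Γ.IsNodeSplit u A B) (l : V) :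
    l ∈ (Γ.nodeSplit u A B).A splitExt' ↔
      ∃ a ∈ A ∩ setNeighbors Γ.labels B, l ∈ Γ.A (Sum.inl a) := by
  simp only [h.mem_A_splitExt'_iff hs, ← h.mem_A_nodeSplit hs]
  rfl

end

end PreGLT

/-! ### Splits, cliques and stars under isomorphisms -/

section Iso

variable {W W' : Type*} {H : SimpleGraph W} {H' : SimpleGraph W'}

theorem IsSplit.preimage_iso (e : H ≃g H') {A B : Set W'} (h : IsSplit H' A B) :
    IsSplit H (e ⁻¹' A) (e ⁻¹' B) := by
  obtain ⟨hc, hA, hB, hadj⟩ := h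
  have hn : ∀ {X : Set W'} {a : W}, a ∈ setNeighbors H (e ⁻¹' X) → e a ∈ setNeighbors H' X := by
    rintro X a ⟨ha, s, hs, hsa⟩
    exact ⟨ha, e s, hs, e.map_adj_iff.2 hsa⟩
  refine ⟨?_, hA.preimage e.surjective, hB.preimage e.surjective, fun a ha b hb => ?_⟩
  · rw [← hc.compl_eq, Set.preimage_compl]
    exact isCompl_compl
  · exact e.map_adj_iff.1 (hadj _ (hn ha) _ (hn hb))

theorem IsPrimeGraph.of_iso (e : H ≃g H') (h : IsPrimeGraph H) : IsPrimeGraph H' :=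
  ⟨e.connected_iff.1 h.1, fun _ _ hs => h.2 _ _ (hs.preimage_iso e)⟩

theorem IsCliqueGraph.of_iso (e : H ≃g H') (h : IsCliqueGraph H) : IsCliqueGraph H' := by
  have hH : ∀ x y, H.Adj x y ↔ x ≠ y := fun x y => by rw [h, SimpleGraph.top_adj]
  ext a b
  rw [← e.symm.map_adj_iff, hH]
  simp

theorem IsStarWithCentre.of_iso (e : H ≃g H') {c : W} (h : IsStarWithCentre H c) :
    IsStarWithCentre H' (e c) := by
  refine ⟨h.1.trans_eq (Nat.card_congr e.toEquiv), ?_⟩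
  have hH : ∀ x y, H.Adj x y ↔ x ≠ y ∧ (x = c ∨ y = c) := fun x y => by
    rw [h.2, SimpleGraph.starGraph_adj]
  ext a b
  rw [← e.symm.map_adj_iff, hH, SimpleGraph.starGraph_adj]
  simp [RelIso.symm_apply_eq]

theorem IsStarGraph.of_iso (e : H ≃g H') (h : IsStarGraph H) : IsStarGraph H' :=
  h.elim fun _ hc => ⟨_, hc.of_iso e⟩

theorem IsDegenerate.of_iso (e : H ≃g H') (h : IsDegenerate H) : IsDegenerate H' :=
  h.imp (IsCliqueGraph.of_iso e) (IsStarGraph.of_iso e)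

end Iso

namespace PreGLT

variable {V N M : Type*} {Γ : PreGLT V N M}

/-! ### Clique nodes and star nodes in terms of marker vertices -/

theorem isCliqueGraph_label_iff {u : N} : IsCliqueGraph (Γ.label u) ↔
    ∀ a b, Γ.node a = u → Γ.node b = u → a ≠ b → Γ.labels.Adj a b := by
  constructor
  · intro h a b ha hb hab
    have : (Γ.label u).Adj ⟨a, ha⟩ ⟨b, hb⟩ := by
      rw [h]
      exact fun e => hab (congrArg Subtype.val e)
    exact this
  · intro h
    ext ⟨a, ha⟩ ⟨b, hb⟩
    refine ⟨fun hadj => hadj.ne, fun hne => h a b ha hb fun e => hne (Subtype.ext e)⟩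

theorem isStarWithCentre_label_iff {u : N} (c : Γ.markers u) :
    IsStarWithCentre (Γ.label u) c ↔ Γ.IsCentre c.1 := by
  obtain ⟨c, rfl⟩ := c
  rfl

theorem isStarGraph_label_iff {u : N} :
    IsStarGraph (Γ.label u) ↔ ∃ m, Γ.node m = u ∧ Γ.IsCentre m := by
  constructor
  · rintro ⟨c, hc⟩
    exact ⟨c.1, c.2, (isStarWithCentre_label_iff c).1 hc⟩
  · rintro ⟨m, hm, hc⟩
    exact ⟨⟨m, hm⟩, (isStarWithCentre_label_iff _).2 hc⟩

theorem IsGLT.isCentre_iff (h : Γ.IsGLT) {m : M} : Γ.IsCentre m ↔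
    ∀ a b, Γ.node a = Γ.node m → Γ.node b = Γ.node m →
      (Γ.labels.Adj a b ↔ a ≠ b ∧ (a = m ∨ b = m)) := by
  constructor
  · rintro ⟨-, hs⟩ a b ha hb
    change (Γ.label (Γ.node m)).Adj ⟨a, ha⟩ ⟨b, hb⟩ ↔ _
    rw [hs, SimpleGraph.starGraph_adj]
    simp [Subtype.ext_iff]
  · intro hadj
    refine ⟨(h.three_le _).trans_eq (Nat.card_coe_set_eq _).symm, ?_⟩
    ext ⟨a, ha⟩ ⟨b, hb⟩
    rw [SimpleGraph.starGraph_adj]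
    refine (hadj a b ha hb).trans ?_
    simp [Subtype.ext_iff]

theorem IsGLT.exists_two_others (h : Γ.IsGLT) (m : M) : ∃ a b, Γ.node a = Γ.node m ∧
    Γ.node b = Γ.node m ∧ a ≠ b ∧ a ≠ m ∧ b ≠ m := by
  have hm : m ∈ Γ.markers (Γ.node m) := rfl
  have h2 : 1 < (Γ.markers (Γ.node m) \ {m}).ncard := by
    have := h.three_le (Γ.node m)
    rw [Set.ncard_sdiff_singleton_of_mem hm]
    omega
  obtain ⟨a, b, ha, hb, hab⟩ := (Set.one_lt_ncard_iff (Set.finite_of_ncard_pos (by omega))).1 h2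
  exact ⟨a, b, ha.1, hb.1, hab, ha.2, hb.2⟩

theorem IsGLT.not_isCentre_of_isCliqueGraph (h : Γ.IsGLT) {m : M}
    (hc : IsCliqueGraph (Γ.label (Γ.node m))) : ¬ Γ.IsCentre m := by
  intro hm
  obtain ⟨a, b, ha, hb, hab, ham, hbm⟩ := h.exists_two_others m
  have := ((h.isCentre_iff.1 hm) a b ha hb).1 (isCliqueGraph_label_iff.1 hc a b ha hb hab)
  exact this.2.elim ham hbm

theorem IsGLT.not_isStarGraph_of_isCliqueGraph (h : Γ.IsGLT) {u : N}
    (hc : IsCliqueGraph (Γ.label u)) : ¬ IsStarGraph (Γ.label u) := by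
  rw [isStarGraph_label_iff]
  rintro ⟨m, rfl, hm⟩
  exact h.not_isCentre_of_isCliqueGraph hc hm

/-- Two further vertices are both adjacent to `m`; if `m' ≠ m` were a centre too, each of these
edges would have to contain `m'`, so the two vertices would coincide. -/
theorem IsGLT.isCentre_unique (h : Γ.IsGLT) {m m' : M} (hm : Γ.IsCentre m) (hm' : Γ.IsCentre m')
    (hn : Γ.node m = Γ.node m') : m = m' := by
  by_contra hne
  obtain ⟨a, b, ha, hb, hab, ham, hbm⟩ := h.exists_two_others m
  have h1 := (h.isCentre_iff.1 hm a m ha rfl).2 ⟨ham, Or.inr rfl⟩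
  have h2 := (h.isCentre_iff.1 hm b m hb rfl).2 ⟨hbm, Or.inr rfl⟩
  have h1' := ((h.isCentre_iff.1 hm' a m (ha.trans hn) hn).1 h1).2.resolve_right hne
  have h2' := ((h.isCentre_iff.1 hm' b m (hb.trans hn) hn).1 h2).2.resolve_right hne
  exact hab (h1'.trans h2'.symm)

theorem IsGLT.isCentre_iff_eq (h : Γ.IsGLT) {m c : M} (hc : Γ.IsCentre c)
    (hn : Γ.node m = Γ.node c) : Γ.IsCentre m ↔ m = c :=
  ⟨fun hm => h.isCentre_unique hm hc hn, fun e => e ▸ hc⟩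

theorem IsGLT.exists_adj (h : Γ.IsGLT)
    (hr : ∀ u, IsPrimeGraph (Γ.label u) ∨ IsDegenerate (Γ.label u)) (m : M) :
    ∃ m', Γ.labels.Adj m m' := by
  obtain ⟨a, b, ha, hb, hab, ham, hbm⟩ := h.exists_two_others m
  rcases hr (Γ.node m) with hp | hc | hs
  · have : Nontrivial (Γ.markers (Γ.node m)) :=
      ⟨⟨a, ha⟩, ⟨m, rfl⟩, fun e => ham (congrArg Subtype.val e)⟩
    obtain ⟨m', hm'⟩ := hp.1.preconnected.exists_adj_of_nontrivial (⟨m, rfl⟩ : Γ.markers (Γ.node m))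
    exact ⟨m'.1, hm'⟩
  · exact ⟨a, isCliqueGraph_label_iff.1 hc m a rfl ha ham.symm⟩
  · obtain ⟨c, hn, hc⟩ := isStarGraph_label_iff.1 hs
    by_cases hcm : m = c
    · subst hcm
      exact ⟨a, (h.isCentre_iff.1 hc m a hn ha).2 ⟨ham.symm, Or.inl rfl⟩⟩
    · exact ⟨c, (h.isCentre_iff.1 hc m c hn.symm rfl).2 ⟨hcm, Or.inr rfl⟩⟩

/-! ### Nodes with the same label -/

/-- `f` restricts to an isomorphism of the label of `u` onto the label of `u'`. -/
structure SameLabel {V' N' M' : Type*} (Γ : PreGLT V N M) (Γ' : PreGLT V' N' M') (u : N) (u' : N')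
    (f : M → M') : Prop where
  injective : Function.Injective f
  node_eq : ∀ m, Γ.node m = u → Γ'.node (f m) = u'
  exists_eq : ∀ m', Γ'.node m' = u' → ∃ m, Γ.node m = u ∧ f m = m'
  adj_iff : ∀ a b, Γ.node a = u → Γ.node b = u →
    (Γ'.labels.Adj (f a) (f b) ↔ Γ.labels.Adj a b)

namespace SameLabel

variable {V' N' M' : Type*} {Γ' : PreGLT V' N' M'} {u : N} {u' : N'} {f : M → M'}

theorem exists_iso (h : SameLabel Γ Γ' u u' f) :
    ∃ e : Γ.label u ≃g Γ'.label u', ∀ m, (e m).1 = f m.1 := by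
  refine ⟨⟨Equiv.ofBijective (fun m => ⟨f m.1, h.node_eq m.1 m.2⟩) ⟨fun a b hab => ?_, ?_⟩, ?_⟩, ?_⟩
  · exact Subtype.ext (h.injective (congrArg Subtype.val hab))
  · rintro ⟨m', hm'⟩
    obtain ⟨m, hm, rfl⟩ := h.exists_eq m' hm'
    exact ⟨⟨m, hm⟩, rfl⟩
  · intro a b
    exact h.adj_iff a.1 b.1 a.2 b.2
  · exact fun _ => rfl

theorem isCliqueGraph_iff (h : SameLabel Γ Γ' u u' f) :
    IsCliqueGraph (Γ'.label u') ↔ IsCliqueGraph (Γ.label u) := by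
  obtain ⟨e, -⟩ := h.exists_iso
  exact ⟨IsCliqueGraph.of_iso e.symm, IsCliqueGraph.of_iso e⟩

theorem isStarGraph_iff (h : SameLabel Γ Γ' u u' f) :
    IsStarGraph (Γ'.label u') ↔ IsStarGraph (Γ.label u) := by
  obtain ⟨e, -⟩ := h.exists_iso
  exact ⟨IsStarGraph.of_iso e.symm, IsStarGraph.of_iso e⟩

theorem prime_or_degenerate (h : SameLabel Γ Γ' u u' f)
    (hu : IsPrimeGraph (Γ.label u) ∨ IsDegenerate (Γ.label u)) :
    IsPrimeGraph (Γ'.label u') ∨ IsDegenerate (Γ'.label u') := by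
  obtain ⟨e, -⟩ := h.exists_iso
  exact hu.imp (IsPrimeGraph.of_iso e) (IsDegenerate.of_iso e)

theorem isCentre_iff (h : SameLabel Γ Γ' u u' f) {m : M} (hm : Γ.node m = u) :
    Γ'.IsCentre (f m) ↔ Γ.IsCentre m := by
  obtain ⟨e, he⟩ := h.exists_iso
  have h1 := isStarWithCentre_label_iff (Γ := Γ) (u := u) ⟨m, hm⟩
  have h2 := isStarWithCentre_label_iff (e ⟨m, hm⟩)
  rw [he] at h2
  rw [← h2]
  refine Iff.trans ?_ h1
  refine ⟨fun hc => ?_, IsStarWithCentre.of_iso e⟩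
  have := hc.of_iso e.symm
  rwa [RelIso.symm_apply_apply] at this

end SameLabel

/-! ### Reducedness after adding a marker vertex -/

section AddMarker

variable {u : N} {Q : Set M}

theorem sameLabel_addMarker {w : N} (hw : w ≠ u) : SameLabel Γ (Γ.addMarker u Q) w w some where
  injective := Option.some_injective M
  node_eq _ hm := hm
  exists_eq
    | none, hm => absurd hm hw.symm
    | some m, hm => ⟨m, hm, rfl⟩
  adj_iff _ _ _ _ := Iff.rfl

/-- The new marker vertex faces a leaf, so every tree-edge between two nodes is an old one. A join
remains impossible if the new label of `u` is a clique or star only when the old one was, with the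
same status of old centres. -/
theorem IsReduced.addMarker (hr : Γ.IsReduced)
    (hu : IsPrimeGraph ((Γ.addMarker u Q).label u) ∨ IsDegenerate ((Γ.addMarker u Q).label u))
    (hclique : IsCliqueGraph ((Γ.addMarker u Q).label u) → IsCliqueGraph (Γ.label u))
    (hstar : IsStarGraph ((Γ.addMarker u Q).label u) → IsStarGraph (Γ.label u) ∧
      ∀ m, Γ.node m = u → ((Γ.addMarker u Q).IsCentre (some m) ↔ Γ.IsCentre m)) :
    (Γ.addMarker u Q).IsReduced := by
  have hclique' : ∀ w, IsCliqueGraph ((Γ.addMarker u Q).label w) → IsCliqueGraph (Γ.label w) := by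
    intro w
    by_cases hw : w = u
    · subst hw
      exact hclique
    · exact (sameLabel_addMarker hw).isCliqueGraph_iff.1
  have hstar' : ∀ m, IsStarGraph ((Γ.addMarker u Q).label (Γ.node m)) →
      IsStarGraph (Γ.label (Γ.node m)) ∧
        ((Γ.addMarker u Q).IsCentre (some m) ↔ Γ.IsCentre m) := by
    intro m hs
    by_cases hw : Γ.node m = u
    · subst hw
      exact ⟨(hstar hs).1, (hstar hs).2 m rfl⟩
    · have := sameLabel_addMarker (Γ := Γ) (Q := Q) hw
      exact ⟨this.isStarGraph_iff.1 hs, this.isCentre_iff rfl⟩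
  have hopp : ∀ m m', (Γ.addMarker u Q).opp (Sum.inl m) = Sum.inl m' →
      ∃ a b, m = some a ∧ m' = some b ∧ Γ.opp (Sum.inl a) = Sum.inl b := by
    rintro (_ | a) m' h
    · simp at h
    · have h' : Sum.map some some (Γ.opp (Sum.inl a)) = Sum.inl m' := h
      cases hb : Γ.opp (Sum.inl a) with
      | inl b =>
        rw [hb] at h'
        exact ⟨a, b, rfl, (Sum.inl_injective h').symm, hb⟩
      | inr v =>
        rw [hb] at h'
        simp at h'
  refine ⟨fun w => ?_, fun m m' h => ?_, fun m m' h => ?_⟩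
  · by_cases hw : w = u
    · subst hw
      exact hu
    · exact (sameLabel_addMarker hw).prime_or_degenerate (hr.prime_or_degenerate w)
  · obtain ⟨a, b, rfl, rfl, hab⟩ := hopp m m' h
    exact fun hc => hr.no_clique_join a b hab ⟨hclique' _ hc.1, hclique' _ hc.2⟩
  · obtain ⟨a, b, rfl, rfl, hab⟩ := hopp m m' h
    rintro ⟨h1, h2, h3⟩
    obtain ⟨ha, ha'⟩ := hstar' a h1
    obtain ⟨hb, hb'⟩ := hstar' b h2
    rw [ha', hb'] at h3
    exact hr.no_star_join a b hab ⟨ha, hb, h3⟩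

end AddMarker

/-! ### Reducedness after a subdivision -/

section Subdivide

variable {p : M ⊕ V} {K : SimpleGraph (Fin 3)}

theorem sameLabel_subdivide (w : N) : SameLabel Γ (Γ.subdivide p K) w (some w) Sum.inl where
  injective := Sum.inl_injective
  node_eq _ hm := congrArg some hm
  exists_eq
    | Sum.inl m, hm => ⟨m, Option.some_injective _ hm, rfl⟩
    | Sum.inr i, hm => absurd hm (by simp)
  adj_iff _ _ _ _ := Iff.rfl

theorem isCliqueGraph_subdivide_none_iff :
    IsCliqueGraph ((Γ.subdivide p K).label none) ↔ K = ⊤ := by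
  rw [isCliqueGraph_label_iff]
  constructor
  · intro h
    ext i j
    exact ⟨fun hadj => hadj.ne, fun hne =>
      h (Sum.inr i) (Sum.inr j) rfl rfl fun e => hne (Sum.inr_injective e)⟩
  · rintro rfl (a | i) (b | j) ha hb hab
    · simp at ha
    · simp at ha
    · simp at hb
    · exact fun e => hab (congrArg _ e)

theorem IsGLT.isCentre_subdivide_iff (h : (Γ.subdivide p K).IsGLT) (i : Fin 3) :
    (Γ.subdivide p K).IsCentre (Sum.inr i) ↔ K = SimpleGraph.starGraph i := by
  rw [h.isCentre_iff]
  constructor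
  · intro hc
    ext j k
    rw [SimpleGraph.starGraph_adj]
    refine (hc (Sum.inr j) (Sum.inr k) rfl rfl).trans ?_
    simp
  · rintro rfl (a | j) (b | k) ha hb
    · simp at ha
    · simp at ha
    · simp at hb
    · rw [subdivide_labels_inr_inr, SimpleGraph.starGraph_adj]
      simp

/-- The edge of `p` is exempt from `hclique` and `hstar`, because it no longer joins its old ends.
Thus `Γ` need not be reduced, which matters after a node-split. The last three hypotheses control
the two edges at the new node. -/
theorem isReduced_subdivide (h : (Γ.subdivide p K).IsGLT)
    (hr : ∀ u, IsPrimeGraph (Γ.label u) ∨ IsDegenerate (Γ.label u))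
    (hK : K = ⊤ ∨ ∃ c, K = SimpleGraph.starGraph c)
    (hclique : ∀ m m', Γ.opp (Sum.inl m) = Sum.inl m' → Sum.inl m ≠ p → Sum.inl m ≠ Γ.opp p →
      ¬ (IsCliqueGraph (Γ.label (Γ.node m)) ∧ IsCliqueGraph (Γ.label (Γ.node m'))))
    (hstar : ∀ m m', Γ.opp (Sum.inl m) = Sum.inl m' → Sum.inl m ≠ p → Sum.inl m ≠ Γ.opp p →
      ¬ (IsStarGraph (Γ.label (Γ.node m)) ∧ IsStarGraph (Γ.label (Γ.node m')) ∧
        Xor (Γ.IsCentre m) (Γ.IsCentre m')))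
    (hKclique : K = ⊤ → ∀ m, Sum.inl m = p ∨ Sum.inl m = Γ.opp p →
      ¬ IsCliqueGraph (Γ.label (Γ.node m)))
    (hKstar₀ : K ≠ ⊤ → ∀ m, Sum.inl m = p → IsStarGraph (Γ.label (Γ.node m)) →
      (Γ.IsCentre m ↔ K = SimpleGraph.starGraph 0))
    (hKstar₁ : K ≠ ⊤ → ∀ m, Sum.inl m = Γ.opp p → IsStarGraph (Γ.label (Γ.node m)) →
      (Γ.IsCentre m ↔ K = SimpleGraph.starGraph 1)) :
    (Γ.subdivide p K).IsReduced := by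
  have hopp : ∀ a m', (Γ.subdivide p K).opp (Sum.inl (Sum.inl a)) = Sum.inl m' →
      (m' = Sum.inr 0 ∧ Sum.inl a = p) ∨ (m' = Sum.inr 1 ∧ Sum.inl a = Γ.opp p) ∨
      (Sum.inl a ≠ p ∧ Sum.inl a ≠ Γ.opp p ∧
        ∃ b, m' = Sum.inl b ∧ Γ.opp (Sum.inl a) = Sum.inl b) := by
    intro a m' ham
    by_cases h0 : Sum.inl a = p
    · subst h0
      exact Or.inl ⟨(Sum.inl_injective ((subdivide_opp_left Γ _ K).symm.trans ham)).symm, rfl⟩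
    by_cases h1 : Sum.inl a = Γ.opp p
    · have e := subdivide_opp_right Γ p K
      rw [← h1] at e
      exact Or.inr (Or.inl ⟨(Sum.inl_injective (e.symm.trans ham)).symm, h1⟩)
    · have e := (subdivide_opp_of_ne Γ p K h0 h1).symm.trans ham
      refine Or.inr (Or.inr ⟨h0, h1, ?_⟩)
      cases hb : Γ.opp (Sum.inl a) with
      | inl b =>
        rw [hb] at e
        exact ⟨b, (Sum.inl_injective e).symm, rfl⟩
      | inr v =>
        rw [hb] at e
        simp [oldExt] at e
  have htop : IsStarGraph ((Γ.subdivide p K).label none) → K ≠ ⊤ := fun hs e =>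
    h.not_isStarGraph_of_isCliqueGraph (isCliqueGraph_subdivide_none_iff.2 e) hs
  have hnew : ∀ a i, (Γ.subdivide p K).opp (Sum.inl (Sum.inl a)) = Sum.inl (Sum.inr i) →
      ¬ (IsCliqueGraph ((Γ.subdivide p K).label (some (Γ.node a))) ∧
        IsCliqueGraph ((Γ.subdivide p K).label none)) ∧
      (IsStarGraph ((Γ.subdivide p K).label (some (Γ.node a))) →
        IsStarGraph ((Γ.subdivide p K).label none) →
        ((Γ.subdivide p K).IsCentre (Sum.inl a) ↔ (Γ.subdivide p K).IsCentre (Sum.inr i))) := by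
    intro a i ha
    rw [(sameLabel_subdivide _).isCliqueGraph_iff, isCliqueGraph_subdivide_none_iff,
      (sameLabel_subdivide _).isStarGraph_iff, (sameLabel_subdivide _).isCentre_iff rfl,
      h.isCentre_subdivide_iff]
    rcases hopp a _ ha with ⟨hi, hp⟩ | ⟨hi, hp⟩ | ⟨-, -, b, hb, -⟩
    · cases hi
      exact ⟨fun hc => hKclique hc.2 a (Or.inl hp) hc.1, fun h1 h2 => hKstar₀ (htop h2) a hp h1⟩
    · cases hi
      exact ⟨fun hc => hKclique hc.2 a (Or.inr hp) hc.1, fun h1 h2 => hKstar₁ (htop h2) a hp h1⟩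
    · cases hb
  have hinr : ∀ i j, (Γ.subdivide p K).opp (Sum.inl (Sum.inr i)) ≠ Sum.inl (Sum.inr j) := by
    intro i j
    fin_cases i
    · exact fun e => by cases p <;> simp [oldExt] at e
    · exact fun e => by cases hq : Γ.opp p <;> simp [oldExt, hq] at e
    · simp
  refine ⟨?_, ?_, ?_⟩
  · rintro (_ | w)
    · refine Or.inr (hK.imp isCliqueGraph_subdivide_none_iff.2 ?_)
      rintro ⟨c, hc⟩
      exact isStarGraph_label_iff.2 ⟨Sum.inr c, rfl, (h.isCentre_subdivide_iff c).2 hc⟩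
    · exact (sameLabel_subdivide w).prime_or_degenerate (hr w)
  · rintro (a | i) (b | j) hab
    · rcases hopp a _ hab with ⟨hi, -⟩ | ⟨hi, -⟩ | ⟨h0, h1, b', hb, hab'⟩
      · cases hi
      · cases hi
      · cases hb
        rw [subdivide_node_inl, subdivide_node_inl, (sameLabel_subdivide _).isCliqueGraph_iff,
          (sameLabel_subdivide _).isCliqueGraph_iff]
        exact hclique a b hab' h0 h1
    · exact (hnew a j hab).1
    · exact fun hc => (hnew b i (opp_eq_comm hab)).1 hc.symm
    · exact absurd hab (hinr i j)
  · rintro (a | i) (b | j) hab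
    · rcases hopp a _ hab with ⟨hi, -⟩ | ⟨hi, -⟩ | ⟨h0, h1, b', hb, hab'⟩
      · cases hi
      · cases hi
      · cases hb
        rw [subdivide_node_inl, subdivide_node_inl, (sameLabel_subdivide _).isStarGraph_iff,
          (sameLabel_subdivide _).isStarGraph_iff, (sameLabel_subdivide _).isCentre_iff rfl,
          (sameLabel_subdivide _).isCentre_iff rfl]
        exact hstar a b hab' h0 h1
    · rintro ⟨h1, h2, h3⟩
      rw [(hnew a j hab).2 h1 h2, xor_self] at h3
      exact h3
    · rintro ⟨h1, h2, h3⟩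
      rw [(hnew b i (opp_eq_comm hab)).2 h2 h1, xor_self] at h3
      exact h3
    · exact absurd hab (hinr i j)

end Subdivide

/-! ### Labels after a node-split -/

section NodeSplit

variable {u : N} {A B : Set M}

theorem IsNodeSplit.sameLabel (hs : Γ.IsNodeSplit u A B) {w : N} (hw : w ≠ u) :
    SameLabel Γ (Γ.nodeSplit u A B) w (some w) Sum.inl where
  injective := Sum.inl_injective
  node_eq m hm := by
    rw [nodeSplit_node_of_notMem Γ u A B fun hB => hw (hm ▸ hs.node_eq_of_right hB), hm]
  exists_eq := by
    rintro (m | (_ | _)) hm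
    · refine ⟨m, ?_, rfl⟩
      by_cases hB : m ∈ B
      · rw [nodeSplit_node_of_mem Γ u A B hB] at hm
        simp at hm
      · rw [nodeSplit_node_of_notMem Γ u A B hB] at hm
        exact Option.some_injective _ hm
    · simp at hm
    · exact absurd (Option.some_injective _ hm) hw.symm
  adj_iff a b ha hb := by
    rw [nodeSplit_labels_inl_inl]
    refine and_iff_left ⟨fun h => hw ?_, fun h => hw ?_⟩
    · rw [← ha, hs.node_eq_of_left h.1]
    · rw [← ha, hs.node_eq_of_right h.1]

theorem IsNodeSplit.node_eq_some_iff (hs : Γ.IsNodeSplit u A B) {m : M ⊕ Bool} :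
    (Γ.nodeSplit u A B).node m = some u ↔ (∃ a ∈ A, m = Sum.inl a) ∨ m = Sum.inr true := by
  constructor
  · rcases m with a | (_ | _)
    · intro h
      by_cases hB : a ∈ B
      · rw [nodeSplit_node_of_mem Γ u A B hB] at h
        simp at h
      · rw [nodeSplit_node_of_notMem Γ u A B hB] at h
        exact Or.inl ⟨a, (hs.mem_left_iff (Option.some_injective _ h)).2 hB, rfl⟩
    · simp
    · exact fun _ => Or.inr rfl
  · rintro (⟨a, ha, rfl⟩ | rfl)
    · rw [nodeSplit_node_of_notMem Γ u A B (hs.notMem a ha), hs.node_eq_of_left ha]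
    · rfl

theorem nodeSplit_node_eq_none_iff {m : M ⊕ Bool} :
    (Γ.nodeSplit u A B).node m = none ↔ (∃ b ∈ B, m = Sum.inl b) ∨ m = Sum.inr false := by
  constructor
  · rcases m with a | (_ | _)
    · intro h
      by_cases hB : a ∈ B
      · exact Or.inl ⟨a, hB, rfl⟩
      · rw [nodeSplit_node_of_notMem Γ u A B hB] at h
        simp at h
    · exact fun _ => Or.inr rfl
    · simp
  · rintro (⟨b, hb, rfl⟩ | rfl)
    · exact nodeSplit_node_of_mem Γ u A B hb
    · rfl

theorem IsNodeSplit.adj_of_left (hs : Γ.IsNodeSplit u A B) {a a' : M} (ha : a ∈ A) (ha' : a' ∈ A) :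
    (Γ.nodeSplit u A B).labels.Adj (Sum.inl a) (Sum.inl a') ↔ Γ.labels.Adj a a' :=
  and_iff_left ⟨fun h => hs.notMem _ ha' h.2, fun h => hs.notMem _ ha h.1⟩

theorem IsNodeSplit.adj_of_right (hs : Γ.IsNodeSplit u A B) {b b' : M} (hb : b ∈ B) (hb' : b' ∈ B) :
    (Γ.nodeSplit u A B).labels.Adj (Sum.inl b) (Sum.inl b') ↔ Γ.labels.Adj b b' :=
  and_iff_left ⟨fun h => hs.notMem _ h.1 hb, fun h => hs.notMem _ h.2 hb'⟩

theorem IsNodeSplit.isCliqueGraph_some (hs : Γ.IsNodeSplit u A B)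
    (hu : IsCliqueGraph (Γ.label u)) : IsCliqueGraph ((Γ.nodeSplit u A B).label (some u)) := by
  rw [isCliqueGraph_label_iff] at hu ⊢
  obtain ⟨b, hb⟩ := hs.nontrivial_right.nonempty
  have hA : ∀ a ∈ A, a ∈ A ∩ setNeighbors Γ.labels B := fun a ha =>
    ⟨ha, hs.notMem a ha, b, hb, hu b a (hs.node_eq_of_right hb) (hs.node_eq_of_left ha)
      fun e => hs.notMem a ha (e ▸ hb)⟩
  intro m m' hm hm' hne
  rcases hs.node_eq_some_iff.1 hm with ⟨a, ha, rfl⟩ | rfl <;>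
    rcases hs.node_eq_some_iff.1 hm' with ⟨a', ha', rfl⟩ | rfl
  · exact (hs.adj_of_left ha ha').2
      (hu a a' (hs.node_eq_of_left ha) (hs.node_eq_of_left ha') fun e => hne (congrArg _ e))
  · exact hA a ha
  · exact hA a' ha'
  · exact absurd rfl hne

theorem IsNodeSplit.isCliqueGraph_none (hs : Γ.IsNodeSplit u A B)
    (hu : IsCliqueGraph (Γ.label u)) : IsCliqueGraph ((Γ.nodeSplit u A B).label none) := by
  rw [isCliqueGraph_label_iff] at hu ⊢
  obtain ⟨a, ha⟩ := hs.nontrivial_left.nonempty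
  have hB : ∀ b ∈ B, b ∈ B ∩ setNeighbors Γ.labels A := fun b hb =>
    ⟨hb, fun hbA => hs.notMem b hbA hb, a, ha, hu a b (hs.node_eq_of_left ha)
      (hs.node_eq_of_right hb) fun e => hs.notMem a ha (e ▸ hb)⟩
  intro m m' hm hm' hne
  rcases nodeSplit_node_eq_none_iff.1 hm with ⟨b, hb, rfl⟩ | rfl <;>
    rcases nodeSplit_node_eq_none_iff.1 hm' with ⟨b', hb', rfl⟩ | rfl
  · exact (hs.adj_of_right hb hb').2
      (hu b b' (hs.node_eq_of_right hb) (hs.node_eq_of_right hb') fun e => hne (congrArg _ e))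
  · exact hB b hb
  · exact hB b' hb'
  · exact absurd rfl hne

variable [Finite V] [Finite N] [Finite M]

/-- The vertices of `A` are leaves attached to `c` in `B`, so all of them are frontier vertices and
`q` takes over the role of centre. -/
theorem IsGLT.isCentre_nodeSplit_true (h : Γ.IsGLT) (hs : Γ.IsNodeSplit u A B) {c : M}
    (hc : Γ.IsCentre c) (hcB : c ∈ B) : (Γ.nodeSplit u A B).IsCentre (Sum.inr true) := by
  rw [h.isCentre_iff, hs.node_eq_of_right hcB] at hc
  have hcA : ∀ a ∈ A, a ≠ c := fun a ha e => hs.notMem a ha (e ▸ hcB)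
  have hA : ∀ a ∈ A, a ∈ A ∩ setNeighbors Γ.labels B := fun a ha =>
    ⟨ha, hs.notMem a ha, c, hcB, (hc c a (hs.node_eq_of_right hcB) (hs.node_eq_of_left ha)).2
      ⟨(hcA a ha).symm, Or.inl rfl⟩⟩
  refine (h.nodeSplit hs).isCentre_iff.2 fun m m' hm hm' => ?_
  rcases hs.node_eq_some_iff.1 hm with ⟨a, ha, rfl⟩ | rfl <;>
    rcases hs.node_eq_some_iff.1 hm' with ⟨a', ha', rfl⟩ | rfl
  · rw [hs.adj_of_left ha ha', hc a a' (hs.node_eq_of_left ha) (hs.node_eq_of_left ha')]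
    simp [hcA a ha, hcA a' ha']
  · exact ⟨fun _ => ⟨by simp, Or.inr rfl⟩, fun _ => hA a ha⟩
  · exact ⟨fun _ => ⟨by simp, Or.inl rfl⟩, fun _ => hA a' ha'⟩
  · simp

/-- The frontier in `B` is `c` alone, so `q'` becomes one more leaf of the star around `c`. -/
theorem IsGLT.isCentre_nodeSplit_inl (h : Γ.IsGLT) (hs : Γ.IsNodeSplit u A B) {c : M}
    (hc : Γ.IsCentre c) (hcB : c ∈ B) : (Γ.nodeSplit u A B).IsCentre (Sum.inl c) := by
  rw [h.isCentre_iff, hs.node_eq_of_right hcB] at hc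
  have hcA : ∀ a ∈ A, a ≠ c := fun a ha e => hs.notMem a ha (e ▸ hcB)
  have hB : ∀ b, b ∈ B ∩ setNeighbors Γ.labels A ↔ b = c := by
    intro b
    constructor
    · rintro ⟨hb, -, a, ha, hadj⟩
      exact ((hc a b (hs.node_eq_of_left ha) (hs.node_eq_of_right hb)).1 hadj).2.resolve_left
        (hcA a ha)
    · rintro rfl
      obtain ⟨a, ha⟩ := hs.nontrivial_left.nonempty
      exact ⟨hcB, fun hA => hcA _ hA rfl, a, ha,
        (hc a b (hs.node_eq_of_left ha) (hs.node_eq_of_right hcB)).2 ⟨hcA a ha, Or.inr rfl⟩⟩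
  refine (h.nodeSplit hs).isCentre_iff.2 fun m m' hm hm' => ?_
  rw [nodeSplit_node_of_mem Γ u A B hcB] at hm hm'
  rcases nodeSplit_node_eq_none_iff.1 hm with ⟨b, hb, rfl⟩ | rfl <;>
    rcases nodeSplit_node_eq_none_iff.1 hm' with ⟨b', hb', rfl⟩ | rfl
  · rw [hs.adj_of_right hb hb', hc b b' (hs.node_eq_of_right hb) (hs.node_eq_of_right hb')]
    simp
  · rw [nodeSplit_labels_inl_false, hB]
    simp
  · rw [nodeSplit_labels_false_inl, hB]
    simp
  · simp

end NodeSplit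

end PreGLT

/-! ### Prime graphs -/

theorem IsSplit.symm {W : Type*} {H : SimpleGraph W} {A B : Set W} (h : IsSplit H A B) :
    IsSplit H B A :=
  ⟨h.1.symm, h.2.2.1, h.2.1, fun a ha b hb => (h.2.2.2 b hb a ha).symm⟩

/-- Adding a vertex to a prime graph yields a prime graph, provided that the new vertex is neither
pendant nor a twin. -/
theorem IsPrimeGraph.addVertex {W : Type*} {H : SimpleGraph W} (hH : IsPrimeGraph H) {Q : Set W}
    (hpendant : ∀ m, ∃ q ∈ Q, q ≠ m) (htwin : ∀ m, ∃ m', m' ≠ m ∧ ¬ (m' ∈ Q ↔ H.Adj m m')) :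
    IsPrimeGraph (addVertex H Q) := by
  have hmem : ∀ A B : Set (Option W), none ∈ A → ¬ IsSplit (_root_.addVertex H Q) A B := by
    rintro A B hA ⟨hc, hAnt, hBnt, hadj⟩
    have hiff : ∀ {x}, x ∈ B ↔ x ∉ A := fun {x} => by rw [← hc.compl_eq, Set.mem_compl_iff]
    obtain ⟨x, hx, hxn⟩ := hAnt.exists_ne none
    obtain ⟨m, rfl⟩ := Option.ne_none_iff_exists'.1 hxn
    have hB : (some ⁻¹' B : Set W).Nontrivial := by
      obtain ⟨b, hb, b', hb', hne⟩ := hBnt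
      rcases b with _ | b
      · exact absurd hA (hiff.1 hb)
      rcases b' with _ | b'
      · exact absurd hA (hiff.1 hb')
      exact ⟨b, hb, b', hb', fun e => hne (congrArg some e)⟩
    -- If two old vertices remain beside the new one, the split restricts to a split of `H`.
    by_cases hA' : (some ⁻¹' A : Set W).Nontrivial
    · refine hH.2 (some ⁻¹' A) (some ⁻¹' B) ⟨?_, hA', hB, ?_⟩
      · rw [← hc.compl_eq, Set.preimage_compl]
        exact isCompl_compl
      · rintro a ⟨ha, s, hs, hsa⟩ b ⟨hb, t, ht, htb⟩
        exact hadj (some a) ⟨ha, some s, hs, hsa⟩ (some b) ⟨hb, some t, ht, htb⟩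
    -- Otherwise one side is the new vertex together with `m`. Both have neighbours across, the new
    -- vertex because it is not pendant, so the split condition makes them twins.
    · have hm : ∀ b, b ≠ m → some b ∈ B := by
        intro b hb
        rw [hiff]
        intro hbA
        exact hA' ⟨b, hbA, m, hx, hb⟩
      have hmB : some m ∉ B := fun h => hiff.1 h hx
      have : Nontrivial W := Set.nontrivial_of_nontrivial hB
      obtain ⟨b, hb⟩ := hH.1.preconnected.exists_adj_of_nontrivial m
      have hmN : some m ∈ setNeighbors (_root_.addVertex H Q) B :=
        ⟨hmB, some b, hm b hb.ne', hb.symm⟩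
      obtain ⟨q, hq, hqm⟩ := hpendant m
      have hnN : none ∈ setNeighbors (_root_.addVertex H Q) B :=
        ⟨fun h => hiff.1 h hA, some q, hm q hqm, hq⟩
      obtain ⟨m', hne, hniff⟩ := htwin m
      refine hniff ⟨fun hQ => ?_, fun hadj' => ?_⟩
      · exact hadj _ hmN (some m') ⟨hiff.1 (hm m' hne), none, hA, hQ⟩
      · exact hadj _ hnN (some m') ⟨hiff.1 (hm m' hne), some m, hx, hadj'⟩
  refine ⟨?_, fun A B hs => ?_⟩
  · obtain ⟨q, hq, -⟩ := hpendant hH.1.nonempty.some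
    refine (SimpleGraph.connected_iff_exists_forall_reachable _).2 ⟨some q, ?_⟩
    rintro (_ | w)
    · exact SimpleGraph.Adj.reachable (G := _root_.addVertex H Q) (u := some q) (v := none) hq
    · exact (hH.1 q w).map (⟨some, fun h => h⟩ : H →g _root_.addVertex H Q)
  · by_cases hA : none ∈ A
    · exact hmem A B hA hs
    · refine hmem B A ?_ hs.symm
      rw [← hs.1.compl_eq]
      exact hA

/-- Four vertices are needed, since cliques and stars on three vertices are prime. From four on, the
centre (any vertex of a clique) together with one other vertex is a side of a split. -/
theorem IsPrimeGraph.not_isDegenerate {W : Type*} [Finite W] {H : SimpleGraph W}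
    (hH : IsPrimeGraph H) (hW : 4 ≤ Nat.card W) : ¬ IsDegenerate H := by
  have hsplit : ∀ c, (∀ b, b ≠ c → H.Adj c b) →
      ((∀ a b, a ≠ b → H.Adj a b) ∨ (∀ a b, H.Adj a b → a = c ∨ b = c)) → False := by
    intro c hc hor
    have : Nontrivial W := Finite.one_lt_card_iff_nontrivial.1 (by omega)
    obtain ⟨a, hac⟩ := exists_ne c
    refine hH.2 {c, a} {c, a}ᶜ ⟨isCompl_compl, Set.nontrivial_pair hac.symm, ?_, ?_⟩
    · have h2 := Set.ncard_add_ncard_compl ({c, a} : Set W)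
      rw [Set.ncard_pair hac.symm] at h2
      exact (Set.one_lt_ncard_iff_nontrivial).1 (by omega)
    · rintro x ⟨hx, s, hs, hsx⟩ y ⟨hy, -⟩
      have hx' : x ∈ ({c, a} : Set W) := not_not.1 hx
      have hxy : x ≠ y := fun e => hy (e ▸ hx')
      rcases hor with hall | hstar
      · exact hall x y hxy
      · have hsc : s ≠ c := fun e => hs (by simp [e])
        have hxc : x = c := (hstar s x hsx).resolve_left hsc
        rw [hxc]
        exact hc y fun e => hy (by simp [e])
  rintro (hclique | ⟨c, hstar⟩)
  · have hadj : ∀ a b, a ≠ b → H.Adj a b := fun a b hab => by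
      rw [hclique]
      exact hab
    exact hsplit hH.1.nonempty.some (fun b hb => hadj _ _ hb.symm) (Or.inl hadj)
  · have hadj : ∀ a b, H.Adj a b ↔ a ≠ b ∧ (a = c ∨ b = c) := fun a b => by
      rw [hstar.2, SimpleGraph.starGraph_adj]
    exact hsplit c (fun b hb => (hadj c b).2 ⟨hb.symm, Or.inl rfl⟩)
      (Or.inr fun a b h => ((hadj a b).1 h).2)

/-! ### Three-vertex labels of the new ternary node -/

theorem starGraph_fin_three_ne_top (c : Fin 3) : SimpleGraph.starGraph c ≠ ⊤ := by
  intro e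
  have h : ∀ a b, a ≠ b → a = c ∨ b = c := fun a b hab => by
    have hadj : (SimpleGraph.starGraph c).Adj a b := by
      rw [e]
      exact hab
    exact (SimpleGraph.starGraph_adj.1 hadj).2
  clear e
  revert c
  decide

theorem starGraph_zero_ne_one :
    (SimpleGraph.starGraph 0 : SimpleGraph (Fin 3)) ≠ SimpleGraph.starGraph 1 := by
  intro e
  have h : (SimpleGraph.starGraph 0 : SimpleGraph (Fin 3)).Adj 0 2 := by simp
  rw [e] at h
  simp at h

namespace PreGLT

variable {V N M : Type*} {Γ : PreGLT V N M} {S : Set V}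

theorem nonempty_label_addMarker_iso (u : N) (Q : Set M) :
    Nonempty (addVertex (Γ.label u) (Subtype.val ⁻¹' Q) ≃g (Γ.addMarker u Q).label u) := by
  let f : Option (Γ.markers u) → (Γ.addMarker u Q).markers u := fun m =>
    m.elim ⟨none, rfl⟩ fun m => ⟨some m.1, m.2⟩
  refine ⟨⟨Equiv.ofBijective f ⟨?_, ?_⟩, ?_⟩⟩
  · rintro (_ | a) (_ | b) hab
    · rfl
    · exact absurd (congrArg Subtype.val hab) (by simp [f])
    · exact absurd (congrArg Subtype.val hab) (by simp [f])
    · exact congrArg some (Subtype.ext (Option.some_injective _ (congrArg Subtype.val hab)))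
  · rintro ⟨_ | m, hm⟩
    · exact ⟨none, rfl⟩
    · exact ⟨some ⟨m, hm⟩, rfl⟩
  · rintro (_ | a) (_ | b) <;> exact Iff.rfl

/-! ### Tree-edges and nodes with given states -/

theorem IsSplitTree.exists_adj {G : SimpleGraph V} (h : Γ.IsSplitTree G) (m : M) : ∃ m', Γ.labels.Adj m m' :=
  h.isGLT.exists_adj h.isReduced.prime_or_degenerate m

/-- Both halves `none` and `some u` come from `u`, so `getD u` returns the old node from which a new
one arises. -/
theorem IsNodeSplit.getD_node {u : N} {A B : Set M} (hs : Γ.IsNodeSplit u A B) (m : M) :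
    ((Γ.nodeSplit u A B).node (Sum.inl m)).getD u = Γ.node m := by
  by_cases hm : m ∈ B
  · rw [nodeSplit_node_of_mem Γ u A B hm, hs.node_eq_of_right hm]
    rfl
  · rw [nodeSplit_node_of_notMem Γ u A B hm]
    rfl

theorem not_three_of_eq_or_eq {p q : M ⊕ V} {a b c : M} (hab : a ≠ b) (hac : a ≠ c) (hbc : b ≠ c)
    (ha : Sum.inl a = p ∨ Sum.inl a = q) (hb : Sum.inl b = p ∨ Sum.inl b = q)
    (hc : Sum.inl c = p ∨ Sum.inl c = q) : False := by
  grind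

theorem IsPPEdge.symm {p : M ⊕ V} (h : Γ.IsPPEdge S p) : Γ.IsPPEdge S (Γ.opp p) :=
  ⟨h.2, by rw [Γ.opp_opp]; exact h.1⟩

/-- Uses that the opposite of `m` is not empty: `x` will not be pendant at `m`. -/
theorem IsGLT.exists_perfect_of_isHybrid (h : Γ.IsGLT) {u : N} (hu : Γ.IsHybrid S u) {m : M}
    (hm : Γ.node m = u) :
    ∃ m', Γ.node m' = u ∧ m' ≠ m ∧ Γ.IsPerfect S (Sum.inl m') := by
  have hmix := (hu m hm).2.2
  rw [h.isEmptyState_iff_of_opp_inl (Γ.opp_opp _)] at hmix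
  push Not at hmix
  obtain ⟨m', hn, hne, hm'⟩ := hmix
  exact ⟨m', hn.trans hm, hne, (hu m' (hn.trans hm)).1.resolve_right hm'⟩

/-- The centre of a star belongs to `E*` whichever of its two possible states it has. -/
theorem IsHybrid.isCliqueGraph_or_centre_mem_EStar {u : N}
    (hu : Γ.IsHybrid S u) (hd : IsDegenerate (Γ.label u)) :
    IsCliqueGraph (Γ.label u) ∨ ∃ c ∈ Γ.EStar S u, Γ.IsCentre c := by
  refine hd.imp id fun hs => ?_
  obtain ⟨c, hcu, hc⟩ := isStarGraph_label_iff.1 hs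
  exact ⟨c, ⟨hcu, (hu c hcu).1.symm.imp id fun hp => ⟨hp, hc⟩⟩, hc⟩

section

variable [Finite V] [Finite N]

/-- Uses that the opposite of `m` is not perfect: `x` will not be a twin of `m`. -/
theorem IsGLT.exists_ne_of_isHybrid (h : Γ.IsGLT) {u : N} (hu : Γ.IsHybrid S u)
    {m : M} (hm : Γ.node m = u) :
    ∃ m', Γ.node m' = u ∧ m' ≠ m ∧ ¬ (Γ.IsPerfect S (Sum.inl m') ↔ Γ.labels.Adj m m') := by
  have hmix := (hu m hm).2.1
  rw [h.isPerfect_iff_of_opp_inl (Γ.opp_opp _)] at hmix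
  by_contra hcon
  push Not at hcon
  refine hmix fun m' hn hne => ?_
  have hiff := hcon m' (hn.trans hm) hne
  exact ⟨hiff.2, fun hna => (hu m' (hn.trans hm)).1.resolve_left fun hp => hna (hiff.1 hp)⟩

/-- Perfection of `m` and of its opposite makes all marker vertices of the clique perfect, and then
all their opposites too. A unique such edge therefore has no clique at its ends. -/
theorem IsGLT.isPPEdge_of_isCliqueGraph (h : Γ.IsGLT) {m m' : M}
    (hc : IsCliqueGraph (Γ.label (Γ.node m))) (hm : Γ.IsPPEdge S (Sum.inl m))
    (hm' : Γ.node m' = Γ.node m) : Γ.IsPPEdge S (Sum.inl m') := by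
  rw [isCliqueGraph_label_iff] at hc
  have hperf : ∀ a, Γ.node a = Γ.node m → Γ.IsPerfect S (Sum.inl a) := by
    intro a ha
    by_cases ham : a = m
    · exact ham ▸ hm.1
    · exact ((h.isPerfect_iff_of_opp_inl (Γ.opp_opp _)).1 hm.2 a ha ham).1
        (hc m a rfl ha (Ne.symm ham))
  refine ⟨hperf m' hm', (h.isPerfect_iff_of_opp_inl (Γ.opp_opp _)).2 fun a ha ham => ?_⟩
  exact ⟨fun _ => hperf a (ha.trans hm'),
    fun hna => absurd (hc m' a hm' (ha.trans hm') ham.symm) hna⟩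

/-- All the tree-edges at a star with perfect centre and empty leaves join a perfect and an empty
extremity. -/
theorem IsGLT.isPEEdge_of_isCentre (h : Γ.IsGLT) {c : M} (hc : Γ.IsCentre c)
    (hperf : Γ.IsPerfect S (Sum.inl c))
    (hempty : ∀ m, Γ.node m = Γ.node c → m ≠ c → Γ.IsEmptyState S (Sum.inl m)) {m : M}
    (hm : Γ.node m = Γ.node c) :
    Γ.IsPEEdge S (Sum.inl m) ∨ Γ.IsPEEdge S (Γ.opp (Sum.inl m)) := by
  by_cases hmc : m = c
  · subst hmc
    exact Or.inl ⟨hperf, (h.isEmptyState_iff_of_opp_inl (Γ.opp_opp _)).2 hempty⟩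
  · refine Or.inr ⟨(h.isPerfect_iff_of_opp_inl (Γ.opp_opp _)).2 fun a ha ham => ?_, ?_⟩
    · rw [h.isCentre_iff.1 hc m a hm (ha.trans hm)]
      by_cases hac : a = c
      · exact ⟨fun _ => hac ▸ hperf, fun hna => absurd ⟨ham.symm, Or.inr hac⟩ hna⟩
      · exact ⟨fun hadj => absurd hadj.2 (by simp [hmc, hac]), fun _ => hempty a (ha.trans hm) hac⟩
    · rw [Γ.opp_opp]
      exact hempty m hm hmc

theorem IsSplitTree.isNodeSplit_starSplit {G : SimpleGraph V} {u : N} (h : Γ.IsSplitTree G)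
    (hu : Γ.IsHybrid S u) (hd : IsDegenerate (Γ.label u)) :
    Γ.IsNodeSplit u (Γ.PStar S u) (Γ.EStar S u) := by
  have hexcl : ∀ {m}, Γ.IsPerfect S (Sum.inl m) → ¬ Γ.IsEmptyState S (Sum.inl m) :=
    h.isGLT.not_isEmptyState_of_isPerfect h.exists_adj
  have hnonempty : (Γ.markers u).Nonempty := by
    refine Set.nonempty_of_ncard_ne_zero ?_
    have := h.isGLT.three_le u
    omega
  obtain ⟨m₀, hm₀⟩ := hnonempty
  refine ⟨fun m => ⟨fun hm => hm.elim And.left And.left, fun hm => ?_⟩, fun m hm hm' => ?_, ?_, ?_,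
    ?_⟩
  · by_cases hc : Γ.IsCentre m
    · exact Or.inr ⟨hm, (hu m hm).1.symm.imp id fun hp => ⟨hp, hc⟩⟩
    · exact (hu m hm).1.imp (fun hp => ⟨hm, hp, hc⟩) fun he => ⟨hm, Or.inl he⟩
  · exact hm'.2.elim (hexcl hm.2.1) fun hc => hm.2.2 hc.2
  · rcases hd with hcl | hs
    · have hmem : ∀ m, Γ.node m = u → Γ.IsPerfect S (Sum.inl m) → m ∈ Γ.PStar S u := by
        rintro m rfl hp
        exact ⟨rfl, hp, h.isGLT.not_isCentre_of_isCliqueGraph hcl⟩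
      obtain ⟨m₁, h₁, -, hp₁⟩ := h.isGLT.exists_perfect_of_isHybrid hu hm₀
      obtain ⟨m₂, h₂, hne, hp₂⟩ := h.isGLT.exists_perfect_of_isHybrid hu h₁
      exact ⟨m₂, hmem m₂ h₂ hp₂, m₁, hmem m₁ h₁ hp₁, hne⟩
    · obtain ⟨c, hcu, hc⟩ := isStarGraph_label_iff.1 hs
      have hmem : ∀ m, Γ.node m = u → m ≠ c → Γ.IsPerfect S (Sum.inl m) → m ∈ Γ.PStar S u :=
        fun m hm hmc hp => ⟨hm, hp, fun hm' =>
          hmc (h.isGLT.isCentre_unique hm' hc (hm.trans hcu.symm))⟩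
      obtain ⟨m₁, h₁, hne₁, hp₁⟩ := h.isGLT.exists_perfect_of_isHybrid hu hcu
      have hadj : ∀ m, Γ.node m = u → m ≠ m₁ → (Γ.labels.Adj m₁ m ↔ m = c) := by
        intro m hm hne
        rw [h.isGLT.isCentre_iff.1 hc m₁ m (h₁.trans hcu.symm) (hm.trans hcu.symm)]
        simp [hne.symm, hne₁]
      obtain ⟨m₂, h₂, hne₂, hp₂⟩ : ∃ m₂, Γ.node m₂ = u ∧ m₂ ≠ m₁ ∧
          (m₂ ≠ c ∧ Γ.IsPerfect S (Sum.inl m₂)) := by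
        -- If `m₁` were the only perfect leaf of the star, the centre would be the only other
        -- perfect marker vertex. As it is the only neighbour of `m₁`, the opposite of `m₁` would be
        -- perfect.
        by_contra hcon
        push Not at hcon
        obtain ⟨m₃, h₃, hne₃, hp₃⟩ := h.isGLT.exists_perfect_of_isHybrid hu h₁
        obtain ⟨m₂, h₂, hne₂, hiff⟩ := h.isGLT.exists_ne_of_isHybrid hu h₁
        have h3c : m₃ = c := by
          by_contra hne
          exact hcon m₃ h₃ hne₃ hne hp₃
        refine hiff ?_
        rw [hadj m₂ h₂ hne₂]
        refine ⟨fun hp => ?_, fun e => ?_⟩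
        · by_contra hne
          exact hcon m₂ h₂ hne₂ hne hp
        · rw [e, ← h3c]
          exact hp₃
      exact ⟨m₂, hmem m₂ h₂ hp₂.1 hp₂.2, m₁, hmem m₁ h₁ hne₁ hp₁, hne₂⟩
  · have hmem : ∀ m, Γ.node m = u → ¬ Γ.IsPerfect S (Sum.inl m) → m ∈ Γ.EStar S u :=
      fun m hm hp => ⟨hm, Or.inl ((hu m hm).1.resolve_left hp)⟩
    rcases hd with hcl | hs
    · have key : ∀ m, Γ.node m = u → ∃ m', Γ.node m' = u ∧ m' ≠ m ∧
          ¬ Γ.IsPerfect S (Sum.inl m') := by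
        intro m hm
        obtain ⟨m', hm', hne, hiff⟩ := h.isGLT.exists_ne_of_isHybrid hu hm
        have hadj := isCliqueGraph_label_iff.1 hcl m m' hm hm' hne.symm
        exact ⟨m', hm', hne, fun hp => hiff (iff_of_true hp hadj)⟩
      obtain ⟨m₁, h₁, -, hp₁⟩ := key m₀ hm₀
      obtain ⟨m₂, h₂, hne, hp₂⟩ := key m₁ h₁
      exact ⟨m₂, hmem m₂ h₂ hp₂, m₁, hmem m₁ h₁ hp₁, hne⟩
    · obtain ⟨c, hcu, hc⟩ := isStarGraph_label_iff.1 hs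
      -- All leaves of the star are adjacent to the centre, so the opposite of the centre fails to
      -- be perfect only through a leaf that is not perfect. This leaf and the centre lie in `E*`.
      obtain ⟨m', hm', hne, hiff⟩ := h.isGLT.exists_ne_of_isHybrid hu hcu
      have hadj : Γ.labels.Adj c m' :=
        (h.isGLT.isCentre_iff.1 hc c m' rfl (hm'.trans hcu.symm)).2 ⟨hne.symm, Or.inl rfl⟩
      exact ⟨m', hmem m' hm' fun hp => hiff (iff_of_true hp hadj), c,
        ⟨hcu, (hu c hcu).1.symm.imp id fun hp => ⟨hp, hc⟩⟩, hne⟩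
  · rintro a ha b hb ⟨-, s, hs, hsa⟩ ⟨-, t, ht, htb⟩
    rcases hd with hcl | hst
    · refine isCliqueGraph_label_iff.1 hcl a b ha.1 hb.1 ?_
      rintro rfl
      exact hb.2.elim (hexcl ha.2.1) fun hc => ha.2.2 hc.2
    · obtain ⟨c, hcu, hc⟩ := isStarGraph_label_iff.1 hst
      have hnode : ∀ {m}, m ∈ Γ.markers u → Γ.node m = Γ.node c := fun hm =>
        Eq.trans hm hcu.symm
      have hbc : b = c :=
        ((h.isGLT.isCentre_iff.1 hc t b (hnode ht.1) (hnode hb.1)).1 htb).2.resolve_left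
          fun e => ht.2.2 (e ▸ hc)
      have hac : a ≠ c := fun e => ha.2.2 (e ▸ hc)
      exact (h.isGLT.isCentre_iff.1 hc a b (hnode ha.1) (hnode hb.1)).2
        ⟨hbc ▸ hac, Or.inr hbc⟩

/-- Needed for `q'` to be perfect: no perfect marker vertex of `P*` may be cut off from the new
edge. -/
theorem IsSplitTree.PStar_subset_setNeighbors {G : SimpleGraph V} {u : N} (h : Γ.IsSplitTree G)
    (hu : Γ.IsHybrid S u) (hd : IsDegenerate (Γ.label u)) :
    ∀ a ∈ Γ.PStar S u, a ∈ setNeighbors Γ.labels (Γ.EStar S u) := by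
  have hs := h.isNodeSplit_starSplit hu hd
  intro a ha
  refine ⟨hs.notMem a ha, ?_⟩
  rcases hu.isCliqueGraph_or_centre_mem_EStar hd with hcl | ⟨c, hcE, hc⟩
  · obtain ⟨b, hb⟩ := hs.nontrivial_right.nonempty
    exact ⟨b, hb, isCliqueGraph_label_iff.1 hcl b a hb.1 ha.1 fun e => hs.notMem a ha (e ▸ hb)⟩
  · refine ⟨c, hcE, (h.isGLT.isCentre_iff.1 hc c a rfl (Eq.trans ha.1 hcE.1.symm)).2
      ⟨?_, Or.inl rfl⟩⟩
    rintro rfl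
    exact ha.2.2 hc

end

section

variable [Finite V] [Finite N] [Finite M] {G : SimpleGraph V}

/-! ### Insertion at a node -/

theorem IsSplitTree.addMarker_of (h : Γ.IsSplitTree G) {u : N}
    (hu : ∀ m, Γ.node m = u → Γ.IsPerfect S (Sum.inl m) ∨ Γ.IsEmptyState S (Sum.inl m))
    (hr : (Γ.addMarker u (Γ.P S u)).IsReduced) :
    (Γ.addMarker u (Γ.P S u)).IsSplitTree (addVertex G S) where
  isGLT := h.isGLT.addMarker fun _ hm => hm.1
  isReduced := hr
  accessibilityGraph_eq := by
    rw [h.isGLT.accessibilityGraph_addMarker hu, h.accessibilityGraph_eq]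

theorem IsSplitTree.addMarker_of_isPerfectClique (h : Γ.IsSplitTree G) {u : N}
    (hu : Γ.IsPerfectClique S u) :
    (Γ.addMarker u (Γ.P S u)).IsSplitTree (addVertex G S) := by
  have h' : (Γ.addMarker u (Γ.P S u)).IsGLT := h.isGLT.addMarker fun _ hm => hm.1
  have hc : IsCliqueGraph ((Γ.addMarker u (Γ.P S u)).label u) := by
    rw [isCliqueGraph_label_iff]
    rintro (_ | a) (_ | b) ha hb hab
    · exact absurd rfl hab
    · exact ⟨hb, hu.2 b hb⟩
    · exact ⟨ha, hu.2 a ha⟩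
    · exact isCliqueGraph_label_iff.1 hu.1 a b ha hb fun e => hab (congrArg some e)
  refine h.addMarker_of (fun m hm => Or.inl (hu.2 m hm)) ?_
  exact h.isReduced.addMarker (Or.inr (Or.inl hc)) (fun _ => hu.1)
    fun hs => absurd hs (h'.not_isStarGraph_of_isCliqueGraph hc)

theorem IsSplitTree.addMarker_of_isEmptyStar (h : Γ.IsSplitTree G) {u : N}
    (hu : Γ.IsEmptyStar S u) :
    (Γ.addMarker u (Γ.P S u)).IsSplitTree (addVertex G S) := by
  obtain ⟨⟨c, hcu⟩, hstar, hperf, hempty⟩ := hu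
  have h' : (Γ.addMarker u (Γ.P S u)).IsGLT := h.isGLT.addMarker fun _ hm => hm.1
  have hc : Γ.IsCentre c := (isStarWithCentre_label_iff _).1 hstar
  have hP : ∀ m, m ∈ Γ.P S u ↔ m = c := by
    refine fun m => ⟨fun hm => ?_, fun e => e ▸ ⟨hcu, hperf⟩⟩
    by_contra hne
    exact h.isGLT.not_isEmptyState_of_isPerfect h.exists_adj hm.2 (hempty m hm.1 hne)
  have hcu' : Γ.node c = u := hcu
  have hc' : (Γ.addMarker u (Γ.P S u)).IsCentre (some c) := by
    refine h'.isCentre_iff.2 ?_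
    rw [addMarker_node_some, hcu']
    rintro (_ | a) (_ | b) ha hb
    · simp
    · rw [addMarker_labels_none_some, hP]
      simp
    · rw [addMarker_labels_some_none, hP]
      simp
    · rw [addMarker_labels_some_some, h.isGLT.isCentre_iff.1 hc a b (ha.trans hcu'.symm)
        (hb.trans hcu'.symm)]
      simp
  have hs : IsStarGraph ((Γ.addMarker u (Γ.P S u)).label u) :=
    isStarGraph_label_iff.2 ⟨some c, hcu', hc'⟩
  refine h.addMarker_of (fun m hm => ?_) ?_
  · by_cases hmc : m = c
    · exact Or.inl (hmc ▸ hperf)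
    · exact Or.inr (hempty m hm hmc)
  · refine h.isReduced.addMarker (Or.inr (Or.inr hs))
      (fun hcl => absurd hs (h'.not_isStarGraph_of_isCliqueGraph hcl)) fun _ => ⟨⟨_, hstar⟩, ?_⟩
    intro m hm
    rw [h'.isCentre_iff_eq (m := some m) hc' (hm.trans hcu'.symm), Option.some_inj,
      h.isGLT.isCentre_iff_eq hc (hm.trans hcu'.symm)]

theorem IsSplitTree.addMarker_of_isHybrid (h : Γ.IsSplitTree G) {u : N}
    (hu : Γ.IsHybrid S u) (hprime : IsPrimeGraph (Γ.label u)) :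
    (Γ.addMarker u (Γ.P S u)).IsSplitTree (addVertex G S) := by
  obtain ⟨e⟩ := nonempty_label_addMarker_iso (Γ := Γ) u (Γ.P S u)
  have hp : IsPrimeGraph (addVertex (Γ.label u) (Subtype.val ⁻¹' Γ.P S u)) := by
    refine hprime.addVertex (fun m => ?_) fun m => ?_
    · obtain ⟨q, hq, hne, hqp⟩ := h.isGLT.exists_perfect_of_isHybrid hu m.2
      exact ⟨⟨q, hq⟩, ⟨hq, hqp⟩, fun e => hne (congrArg Subtype.val e)⟩
    · obtain ⟨m', hm', hne, hiff⟩ := h.isGLT.exists_ne_of_isHybrid hu m.2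
      refine ⟨⟨m', hm'⟩, fun e => hne (congrArg Subtype.val e), fun hiff' => hiff ?_⟩
      exact ⟨fun hp => hiff'.1 ⟨hm', hp⟩, fun hadj => (hiff'.2 hadj).2⟩
  have hcard : 4 ≤ Nat.card (Option (Γ.markers u)) := by
    have := h.isGLT.three_le u
    rw [Finite.card_option, Nat.card_coe_set_eq]
    omega
  -- A prime label on at least four vertices is neither a clique nor a star, so no join at `u` can
  -- arise.
  have hnd : ¬ IsDegenerate ((Γ.addMarker u (Γ.P S u)).label u) := fun hd =>
    hp.not_isDegenerate hcard (hd.of_iso e.symm)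
  refine h.addMarker_of (fun m hm => (hu m hm).1) ?_
  exact h.isReduced.addMarker (Or.inl (hp.of_iso e)) (fun hc => absurd (Or.inl hc) hnd)
    fun hs => absurd (Or.inr hs) hnd

/-! ### Insertion at a tree-edge -/

theorem IsSplitTree.subdivide_top (h : Γ.IsSplitTree G) {p : M ⊕ V} (hp : Γ.IsPPEdge S p)
    (huniq : ∀ p', Γ.IsPPEdge S p' → p' = p ∨ p' = Γ.opp p) :
    (Γ.subdivide p ⊤).IsSplitTree (addVertex G S) := by
  refine ⟨h.isGLT.subdivide, ?_, ?_⟩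
  · refine isReduced_subdivide h.isGLT.subdivide h.isReduced.prime_or_degenerate (Or.inl rfl)
      (fun m m' hm _ _ => h.isReduced.no_clique_join m m' hm)
      (fun m m' hm _ _ => h.isReduced.no_star_join m m' hm) (fun _ m hm hc => ?_)
      (fun hK => absurd rfl hK) (fun hK => absurd rfl hK)
    have hPP : Γ.IsPPEdge S (Sum.inl m) := by
      rcases hm with hm | hm
      · exact hm ▸ hp
      · exact hm ▸ hp.symm
    -- Three marker vertices of the clique would all be extremities of the one edge of `p`.
    obtain ⟨a, b, ha, hb, hab, ham, hbm⟩ := h.isGLT.exists_two_others m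
    exact not_three_of_eq_or_eq hab ham hbm
      (huniq _ (h.isGLT.isPPEdge_of_isCliqueGraph hc hPP ha))
      (huniq _ (h.isGLT.isPPEdge_of_isCliqueGraph hc hPP hb)) hm
  · rw [h.isGLT.accessibilityGraph_subdivide_top hp, h.accessibilityGraph_eq]

theorem IsSplitTree.subdivide_star (h : Γ.IsSplitTree G) {p : M ⊕ V} (hp : Γ.IsPEEdge S p)
    (huniq : ∀ p', Γ.IsPEEdge S p' → p' = p ∨ p' = Γ.opp p) :
    (Γ.subdivide p (SimpleGraph.starGraph 1)).IsSplitTree (addVertex G S) := by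
  -- A star with perfect centre and empty leaves would have at least three perfect-empty edges. The
  -- two steps below show that a star-join at either end of `p` produces such a star.
  have hno : ∀ c, Γ.IsCentre c → Γ.IsPerfect S (Sum.inl c) →
      ¬ ∀ m, Γ.node m = Γ.node c → m ≠ c → Γ.IsEmptyState S (Sum.inl m) := by
    intro c hc hperf hempty
    have key : ∀ m, Γ.node m = Γ.node c → Sum.inl m = p ∨ Sum.inl m = Γ.opp p := by
      intro m hm
      rcases h.isGLT.isPEEdge_of_isCentre hc hperf hempty hm with he | he
      · exact huniq _ he
      · rcases huniq _ he with e | e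
        · exact Or.inr (by rw [← e, Γ.opp_opp])
        · exact Or.inl (by rw [← Γ.opp_opp (Sum.inl m), e, Γ.opp_opp])
    obtain ⟨a, b, ha, hb, hab, hac, hbc⟩ := h.isGLT.exists_two_others c
    exact not_three_of_eq_or_eq hab hac hbc (key a ha) (key b hb) (key c rfl)
  refine ⟨h.isGLT.subdivide, ?_, ?_⟩
  · refine isReduced_subdivide h.isGLT.subdivide h.isReduced.prime_or_degenerate
      (Or.inr ⟨1, rfl⟩)
      (fun m m' hm _ _ => h.isReduced.no_clique_join m m' hm)
      (fun m m' hm _ _ => h.isReduced.no_star_join m m' hm)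
      (fun hK => absurd hK (starGraph_fin_three_ne_top 1)) (fun _ m hm hs => ?_)
      (fun _ m hm hs => ?_)
    · subst hm
      refine ⟨fun hc => ?_, fun e => absurd e.symm starGraph_zero_ne_one⟩
      exact absurd ((h.isGLT.isEmptyState_iff_of_opp_inl (Γ.opp_opp _)).1 hp.2) (hno m hc hp.1)
    · refine ⟨fun _ => rfl, fun _ => ?_⟩
      obtain ⟨c, hn, hc⟩ := isStarGraph_label_iff.1 hs
      by_contra hmc
      have hne : c ≠ m := fun e => hmc (e ▸ hc)
      -- If `opp p` is a leaf of a star, perfection of `p` makes the centre perfect and the other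
      -- leaves empty; `opp p` itself is empty by assumption.
      have hst := (h.isGLT.isPerfect_iff_of_opp_inl hm.symm).1 hp.1
      refine hno c hc ((hst c hn hne).1 ?_) fun a ha hac => ?_
      · exact (h.isGLT.isCentre_iff.1 hc m c hn.symm rfl).2 ⟨hne.symm, Or.inr rfl⟩
      · by_cases ham : a = m
        · rw [ham, hm]
          exact hp.2
        · refine (hst a (ha.trans hn) ham).2 fun hadj => ?_
          exact ((h.isGLT.isCentre_iff.1 hc m a hn.symm ha).1 hadj).2.elim hne.symm hac
  · rw [h.isGLT.accessibilityGraph_subdivide_star_one hp, h.accessibilityGraph_eq]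

/-! ### Insertion at a degenerate hybrid node -/

section NodeSplit

variable {u : N} {A B : Set M}

theorem IsGLT.isPerfect_splitExt' (h : Γ.IsGLT) (hs : Γ.IsNodeSplit u A B)
    (hperf : ∀ a ∈ A, Γ.IsPerfect S (Sum.inl a)) (hN : ∀ a ∈ A, a ∈ setNeighbors Γ.labels B) :
    (Γ.nodeSplit u A B).IsPerfect S splitExt' := by
  refine isPerfect_iff.2 fun l hl => ?_
  obtain ⟨a, ha, hla⟩ := (h.mem_L_splitExt' hs l).1 hl
  rw [h.mem_A_splitExt' hs]
  refine ⟨fun hS => ⟨a, ⟨ha, hN a ha⟩, (isPerfect_iff.1 (hperf a ha) l hla).1 hS⟩, ?_⟩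
  rintro ⟨a', ha', hl'⟩
  exact (isPerfect_iff.1 (hperf a' ha'.1) l hl'.1).2 hl'

theorem IsGLT.isEmptyState_splitExt (h : Γ.IsGLT) (hs : Γ.IsNodeSplit u A B)
    (hempty : ∀ b ∈ B, Γ.IsEmptyState S (Sum.inl b)) :
    (Γ.nodeSplit u A B).IsEmptyState S splitExt := by
  refine isEmptyState_iff.2 fun l hl => ?_
  obtain ⟨b, hb, hlb⟩ := (h.mem_L_splitExt hs l).1 hl
  exact isEmptyState_iff.1 (hempty b hb) l hlb

theorem IsGLT.isPerfect_splitExt (h : Γ.IsGLT) (hs : Γ.IsNodeSplit u A B) {c : M}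
    (hc : Γ.IsPerfect S (Sum.inl c)) (hN : ∀ b, b ∈ B ∩ setNeighbors Γ.labels A ↔ b = c)
    (hempty : ∀ b ∈ B, b ≠ c → Γ.IsEmptyState S (Sum.inl b)) :
    (Γ.nodeSplit u A B).IsPerfect S splitExt := by
  refine isPerfect_iff.2 fun l hl => ?_
  obtain ⟨b, hb, hlb⟩ := (h.mem_L_splitExt hs l).1 hl
  rw [h.mem_A_splitExt hs]
  constructor
  · intro hS
    have hbc : b = c := by
      by_contra hne
      exact isEmptyState_iff.1 (hempty b hb hne) l hlb hS
    subst hbc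
    exact ⟨b, (hN b).2 rfl, (isPerfect_iff.1 hc l hlb).1 hS⟩
  · rintro ⟨b', hb', hl'⟩
    rw [(hN b').1 hb'] at hl'
    exact (isPerfect_iff.1 hc l hl'.1).2 hl'

theorem IsGLT.nodeSplit_prime_or_degenerate (h : Γ.IsGLT) (hr : Γ.IsReduced)
    (hs : Γ.IsNodeSplit u A B) (hu : IsCliqueGraph (Γ.label u) ∨ ∃ c ∈ B, Γ.IsCentre c)
    (w : Option N) : IsPrimeGraph ((Γ.nodeSplit u A B).label w) ∨
      IsDegenerate ((Γ.nodeSplit u A B).label w) := by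
  rcases w with _ | w
  · refine Or.inr (hu.imp hs.isCliqueGraph_none ?_)
    rintro ⟨c, hcB, hc⟩
    exact isStarGraph_label_iff.2 ⟨_, nodeSplit_node_of_mem Γ u A B hcB,
      h.isCentre_nodeSplit_inl hs hc hcB⟩
  · by_cases hw : w = u
    · subst hw
      refine Or.inr (hu.imp hs.isCliqueGraph_some ?_)
      rintro ⟨c, hcB, hc⟩
      exact isStarGraph_label_iff.2 ⟨Sum.inr true, rfl, h.isCentre_nodeSplit_true hs hc hcB⟩
    · exact (hs.sameLabel hw).prime_or_degenerate (hr.prime_or_degenerate w)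

theorem IsGLT.isCliqueGraph_of_nodeSplit (h : Γ.IsGLT) (hs : Γ.IsNodeSplit u A B)
    (hu : IsCliqueGraph (Γ.label u) ∨ ∃ c ∈ B, Γ.IsCentre c) {w : Option N}
    (hw : IsCliqueGraph ((Γ.nodeSplit u A B).label w)) : IsCliqueGraph (Γ.label (w.getD u)) := by
  have h' := h.nodeSplit hs
  rcases w with _ | w
  · refine hu.resolve_right ?_
    rintro ⟨c, hcB, hc⟩
    rw [← nodeSplit_node_of_mem Γ u A B hcB] at hw
    exact h'.not_isCentre_of_isCliqueGraph hw (h.isCentre_nodeSplit_inl hs hc hcB)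
  · by_cases hwu : w = u
    · subst hwu
      refine hu.resolve_right ?_
      rintro ⟨c, hcB, hc⟩
      exact h'.not_isCentre_of_isCliqueGraph (m := Sum.inr true) hw
        (h.isCentre_nodeSplit_true hs hc hcB)
    · exact (hs.sameLabel hwu).isCliqueGraph_iff.1 hw

theorem IsGLT.isCentre_nodeSplit_iff (h : Γ.IsGLT) (hs : Γ.IsNodeSplit u A B)
    (hu : IsCliqueGraph (Γ.label u) ∨ ∃ c ∈ B, Γ.IsCentre c) (m : M) :
    (Γ.nodeSplit u A B).IsCentre (Sum.inl m) ↔ Γ.IsCentre m := by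
  have h' := h.nodeSplit hs
  by_cases hw : Γ.node m = u
  · rcases hu with hu | ⟨c, hcB, hc⟩
    · refine iff_of_false (fun hm => ?_) (h.not_isCentre_of_isCliqueGraph (hw ▸ hu))
      refine h'.not_isCentre_of_isCliqueGraph ?_ hm
      by_cases hmB : m ∈ B
      · rw [nodeSplit_node_of_mem Γ u A B hmB]
        exact hs.isCliqueGraph_none hu
      · rw [nodeSplit_node_of_notMem Γ u A B hmB, hw]
        exact hs.isCliqueGraph_some hu
    · have hcu := hs.node_eq_of_right hcB
      rw [h.isCentre_iff_eq hc (hw.trans hcu.symm)]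
      by_cases hmB : m ∈ B
      · rw [h'.isCentre_iff_eq (h.isCentre_nodeSplit_inl hs hc hcB)
          (by rw [nodeSplit_node_of_mem Γ u A B hmB, nodeSplit_node_of_mem Γ u A B hcB])]
        simp
      · rw [h'.isCentre_iff_eq (h.isCentre_nodeSplit_true hs hc hcB)
          (by rw [nodeSplit_node_of_notMem Γ u A B hmB, hw]; rfl)]
        exact iff_of_false (by simp) fun e => hmB (e ▸ hcB)
  · have key := (hs.sameLabel hw).isCentre_iff (m := m) rfl
    exact key

theorem IsGLT.isStarGraph_of_nodeSplit (h : Γ.IsGLT) (hs : Γ.IsNodeSplit u A B)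
    (hu : IsCliqueGraph (Γ.label u) ∨ ∃ c ∈ B, Γ.IsCentre c) {w : Option N}
    (hw : IsStarGraph ((Γ.nodeSplit u A B).label w)) : IsStarGraph (Γ.label (w.getD u)) := by
  have h' := h.nodeSplit hs
  have hstar : ¬ IsCliqueGraph (Γ.label u) → IsStarGraph (Γ.label u) := by
    intro hn
    obtain ⟨c, hcB, hc⟩ := hu.resolve_left hn
    exact isStarGraph_label_iff.2 ⟨c, hs.node_eq_of_right hcB, hc⟩
  rcases w with _ | w
  · exact hstar fun hc => h'.not_isStarGraph_of_isCliqueGraph (hs.isCliqueGraph_none hc) hw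
  · by_cases hwu : w = u
    · subst hwu
      exact hstar fun hc => h'.not_isStarGraph_of_isCliqueGraph (hs.isCliqueGraph_some hc) hw
    · exact (hs.sameLabel hwu).isStarGraph_iff.1 hw

/-- Old edges inherit the absence of joins, since cliques split into cliques, stars into stars, and
old marker vertices keep their status as centres. At the new edge of a split star, `q` is a centre
and `q'` is not, which agrees with centre `0` (opposite `q`). Two clique halves are separated by a
star; the clique label is admitted only when `u` is not a clique. -/
theorem IsGLT.isReduced_subdivide_nodeSplit (h : Γ.IsGLT) (hr : Γ.IsReduced)
    (hs : Γ.IsNodeSplit u A B) (hu : IsCliqueGraph (Γ.label u) ∨ ∃ c ∈ B, Γ.IsCentre c)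
    {K : SimpleGraph (Fin 3)} (hK : (K = ⊤ ∧ ¬ IsCliqueGraph (Γ.label u)) ∨
      K = SimpleGraph.starGraph 0) :
    ((Γ.nodeSplit u A B).subdivide splitExt K).IsReduced := by
  have h' := h.nodeSplit hs
  have hopp : ∀ m m', (Γ.nodeSplit u A B).opp (Sum.inl m) = Sum.inl m' →
      Sum.inl m ≠ (splitExt : (M ⊕ Bool) ⊕ V) → Sum.inl m ≠ (Γ.nodeSplit u A B).opp splitExt →
      ∃ a b, m = Sum.inl a ∧ m' = Sum.inl b ∧ Γ.opp (Sum.inl a) = Sum.inl b := by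
    rintro (a | (_ | _)) m' hm h1 h2
    · have hm' : Sum.map Sum.inl id (Γ.opp (Sum.inl a)) = Sum.inl m' := hm
      cases hb : Γ.opp (Sum.inl a) with
      | inl b =>
        rw [hb] at hm'
        exact ⟨a, b, rfl, (Sum.inl_injective hm').symm, hb⟩
      | inr v =>
        rw [hb] at hm'
        simp at hm'
    · exact absurd rfl h2
    · exact absurd rfl h1
  have hK0 : K ≠ ⊤ → K = SimpleGraph.starGraph 0 := fun hne => hK.resolve_left fun e => hne e.1
  have hcentre : ∀ {w : Option N}, w.getD u = u → IsStarGraph ((Γ.nodeSplit u A B).label w) →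
      ∃ c ∈ B, Γ.IsCentre c := by
    intro w hw hstar
    have := h.isStarGraph_of_nodeSplit hs hu hstar
    rw [hw] at this
    exact hu.resolve_left fun hc => h.not_isStarGraph_of_isCliqueGraph hc this
  refine isReduced_subdivide h'.subdivide (h.nodeSplit_prime_or_degenerate hr hs hu)
    (hK.imp And.left fun e => ⟨0, e⟩) (fun m m' hm h1 h2 => ?_) (fun m m' hm h1 h2 => ?_)
    (fun e m hm hc => ?_) (fun hne m hm hstar => ?_) (fun hne m hm hstar => ?_)
  · obtain ⟨a, b, rfl, rfl, hab⟩ := hopp m m' hm h1 h2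
    rintro ⟨ha, hb⟩
    have ha' := h.isCliqueGraph_of_nodeSplit hs hu ha
    have hb' := h.isCliqueGraph_of_nodeSplit hs hu hb
    rw [hs.getD_node] at ha' hb'
    exact hr.no_clique_join a b hab ⟨ha', hb'⟩
  · obtain ⟨a, b, rfl, rfl, hab⟩ := hopp m m' hm h1 h2
    rintro ⟨ha, hb, hx⟩
    have ha' := h.isStarGraph_of_nodeSplit hs hu ha
    have hb' := h.isStarGraph_of_nodeSplit hs hu hb
    rw [hs.getD_node] at ha' hb'
    rw [h.isCentre_nodeSplit_iff hs hu, h.isCentre_nodeSplit_iff hs hu] at hx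
    exact hr.no_star_join a b hab ⟨ha', hb', hx⟩
  · have hnc : ¬ IsCliqueGraph (Γ.label u) := by
      rcases hK with hK | hK
      · exact hK.2
      · exact absurd (hK.symm.trans e) (starGraph_fin_three_ne_top 0)
    have hc' := h.isCliqueGraph_of_nodeSplit hs hu hc
    rcases hm with hm | hm
    · cases hm
      exact hnc hc'
    · cases hm
      exact hnc hc'
  · cases hm
    obtain ⟨c, hcB, hc⟩ := hcentre (w := some u) rfl hstar
    exact iff_of_true (h.isCentre_nodeSplit_true hs hc hcB) (hK0 hne)
  · cases hm
    obtain ⟨c, hcB, hc⟩ := hcentre (w := none) rfl hstar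
    refine iff_of_false (fun hq => ?_) fun e => starGraph_zero_ne_one ((hK0 hne).symm.trans e)
    have := h'.isCentre_unique hq (h.isCentre_nodeSplit_inl hs hc hcB)
      (nodeSplit_node_of_mem Γ u A B hcB).symm
    simp at this

end NodeSplit

/-! ### States of the edge created by the split into `P*` and `E*` -/

section StarSplit

variable {u : N}

theorem IsSplitTree.isPerfect_splitExt' (h : Γ.IsSplitTree G)
    (hu : Γ.IsHybrid S u) (hd : IsDegenerate (Γ.label u)) :
    (Γ.starSplit S u).IsPerfect S splitExt' :=
  h.isGLT.isPerfect_splitExt' (h.isNodeSplit_starSplit hu hd) (fun _ ha => ha.2.1)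
    (h.PStar_subset_setNeighbors hu hd)

theorem IsSplitTree.isEmptyState_splitExt_of_isCliqueGraph (h : Γ.IsSplitTree G)
    (hu : Γ.IsHybrid S u) (hcl : IsCliqueGraph (Γ.label u)) :
    (Γ.starSplit S u).IsEmptyState S splitExt := by
  refine h.isGLT.isEmptyState_splitExt (h.isNodeSplit_starSplit hu (Or.inl hcl)) ?_
  rintro b ⟨rfl, hb⟩
  exact hb.resolve_right fun hc => h.isGLT.not_isCentre_of_isCliqueGraph hcl hc.2

theorem IsSplitTree.isPerfect_or_isEmptyState_splitExt (h : Γ.IsSplitTree G)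
    (hu : Γ.IsHybrid S u) (hd : IsDegenerate (Γ.label u)) :
    (Γ.starSplit S u).IsPerfect S splitExt ∨ (Γ.starSplit S u).IsEmptyState S splitExt := by
  have hs := h.isNodeSplit_starSplit hu hd
  -- With a perfect centre `c` in `E*`, the frontier in `E*` is `c` and the rest of `E*` is empty,
  -- so `q` is perfect. Otherwise all of `E*`, and hence `q`, is empty.
  by_cases hex : ∃ c ∈ Γ.EStar S u, Γ.IsPerfect S (Sum.inl c) ∧ Γ.IsCentre c
  · obtain ⟨c, hcE, hp, hc⟩ := hex
    have hnode : ∀ {m}, m ∈ Γ.markers u → Γ.node m = Γ.node c := fun hm =>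
      Eq.trans hm hcE.1.symm
    refine Or.inl (h.isGLT.isPerfect_splitExt hs hp (fun b => ⟨?_, ?_⟩) fun b hb hbc => ?_)
    · rintro ⟨hb, -, a, ha, hab⟩
      exact ((h.isGLT.isCentre_iff.1 hc a b (hnode ha.1) (hnode hb.1)).1 hab).2.resolve_left
        fun e => ha.2.2 (e ▸ hc)
    · rintro rfl
      obtain ⟨a, ha⟩ := hs.nontrivial_left.nonempty
      exact ⟨hcE, fun hb => hs.notMem b hb hcE, a, ha,
        (h.isGLT.isCentre_iff.1 hc a b (hnode ha.1) rfl).2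
          ⟨fun e => ha.2.2 (e ▸ hc), Or.inr rfl⟩⟩
    · exact hb.2.resolve_right fun hb' =>
        hbc (h.isGLT.isCentre_unique hb'.2 hc (hnode hb.1))
  · refine Or.inr (h.isGLT.isEmptyState_splitExt hs fun b hb => ?_)
    exact hb.2.resolve_right fun hb' => hex ⟨b, hb, hb'⟩

theorem IsSplitTree.not_isEmptyState_of_isPerfect_starSplit (h : Γ.IsSplitTree G)
    (hu : Γ.IsHybrid S u) (hd : IsDegenerate (Γ.label u)) {p : (M ⊕ Bool) ⊕ V}
    (hp : (Γ.starSplit S u).IsPerfect S p) : ¬ (Γ.starSplit S u).IsEmptyState S p := by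
  have hs := h.isNodeSplit_starSplit hu hd
  have h' : (Γ.starSplit S u).IsGLT := h.isGLT.nodeSplit hs
  exact h'.not_isEmptyState_of_isPerfect (h'.exists_adj (h.isGLT.nodeSplit_prime_or_degenerate
    h.isReduced hs (hu.isCliqueGraph_or_centre_mem_EStar hd))) hp

theorem IsSplitTree.subdivide_starSplit_top (h : Γ.IsSplitTree G)
    (hu : Γ.IsHybrid S u) (hd : IsDegenerate (Γ.label u))
    (hp : (Γ.starSplit S u).IsPerfect S splitExt) :
    ((Γ.starSplit S u).subdivide splitExt ⊤).IsSplitTree (addVertex G S) := by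
  have hs := h.isNodeSplit_starSplit hu hd
  have h' : (Γ.starSplit S u).IsGLT := h.isGLT.nodeSplit hs
  refine ⟨h'.subdivide, ?_, ?_⟩
  · refine h.isGLT.isReduced_subdivide_nodeSplit h.isReduced hs
      (hu.isCliqueGraph_or_centre_mem_EStar hd) (Or.inl ⟨rfl, fun hcl => ?_⟩)
    -- If `u` were a clique, `E*` would consist of empty marker vertices and `q` would be empty, not
    -- perfect.
    exact h.not_isEmptyState_of_isPerfect_starSplit hu hd hp
      (h.isEmptyState_splitExt_of_isCliqueGraph hu hcl)
  · rw [h'.accessibilityGraph_subdivide_top ⟨hp, h.isPerfect_splitExt' hu hd⟩,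
      ← h.accessibilityGraph_eq]
    exact congrArg (fun H => addVertex H S) (h.isGLT.accessibilityGraph_nodeSplit hs)

theorem IsSplitTree.subdivide_starSplit_star (h : Γ.IsSplitTree G)
    (hu : Γ.IsHybrid S u) (hd : IsDegenerate (Γ.label u))
    (he : (Γ.starSplit S u).IsEmptyState S splitExt) :
    ((Γ.starSplit S u).subdivide splitExt (SimpleGraph.starGraph 0)).IsSplitTree
      (addVertex G S) := by
  have hs := h.isNodeSplit_starSplit hu hd
  have h' : (Γ.starSplit S u).IsGLT := h.isGLT.nodeSplit hs
  refine ⟨h'.subdivide, ?_, ?_⟩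
  · exact h.isGLT.isReduced_subdivide_nodeSplit h.isReduced hs
      (hu.isCliqueGraph_or_centre_mem_EStar hd) (Or.inr rfl)
  · rw [h'.accessibilityGraph_subdivide_star_zero he (h.isPerfect_splitExt' hu hd),
      ← h.accessibilityGraph_eq]
    exact congrArg (fun H => addVertex H S) (h.isGLT.accessibilityGraph_nodeSplit hs)

end StarSplit

end

end PreGLT

/-! ### Assembly of the six cases -/

theorem mainTheorem4 {V N M : Type*} [Finite V] [Finite N] [Finite M]
    (G : SimpleGraph V) (S : Set V) (Γ : PreGLT V N M)
    (hG : G.Connected) (hGx : (addVertex G S).Connected) (hΓ : Γ.IsSplitTree G) :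
    -- cases 1, 2 and 3
    (∀ u : N,
      ((Γ.IsPerfectClique S u ∧ ∀ v, Γ.IsPerfectClique S v → v = u) ∨
        (Γ.IsEmptyStar S u ∧ ∀ v, Γ.IsEmptyStar S v → v = u) ∨
        ((Γ.IsHybrid S u ∧ ∀ v, Γ.IsHybrid S v → v = u) ∧ IsPrimeGraph (Γ.label u))) →
      (Γ.addMarker u (Γ.P S u)).IsSplitTree (addVertex G S)) ∧
    -- case 4
    (∀ u : N,
      (Γ.IsHybrid S u ∧ ∀ v, Γ.IsHybrid S v → v = u) → IsDegenerate (Γ.label u) →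
      IsSplit (Γ.label u) (Subtype.val ⁻¹' Γ.PStar S u) (Subtype.val ⁻¹' Γ.EStar S u) ∧
      ((Γ.starSplit S u).IsPerfect S PreGLT.splitExt ∨ (Γ.starSplit S u).IsEmptyState S PreGLT.splitExt) ∧
      ((Γ.starSplit S u).IsPerfect S PreGLT.splitExt' ∨ (Γ.starSplit S u).IsEmptyState S PreGLT.splitExt') ∧
      ¬ ((Γ.starSplit S u).IsEmptyState S PreGLT.splitExt ∧
          (Γ.starSplit S u).IsEmptyState S PreGLT.splitExt') ∧
      ((Γ.starSplit S u).IsPerfect S PreGLT.splitExt → (Γ.starSplit S u).IsPerfect S PreGLT.splitExt' →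
        ((Γ.starSplit S u).subdivide PreGLT.splitExt ⊤).IsSplitTree (addVertex G S)) ∧
      ((Γ.starSplit S u).IsEmptyState S PreGLT.splitExt →
        ((Γ.starSplit S u).subdivide PreGLT.splitExt (SimpleGraph.starGraph 0)).IsSplitTree
          (addVertex G S)) ∧
      ((Γ.starSplit S u).IsEmptyState S PreGLT.splitExt' →
        ((Γ.starSplit S u).subdivide PreGLT.splitExt (SimpleGraph.starGraph 1)).IsSplitTree
          (addVertex G S))) ∧
    -- case 5
    (∀ p : M ⊕ V,
      (Γ.IsPPEdge S p ∧ ∀ p', Γ.IsPPEdge S p' → p' = p ∨ p' = Γ.opp p) →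
      (Γ.subdivide p ⊤).IsSplitTree (addVertex G S)) ∧
    -- case 6
    (∀ p : M ⊕ V,
      (Γ.IsPEEdge S p ∧ ∀ p', Γ.IsPEEdge S p' → p' = p ∨ p' = Γ.opp p) →
      (Γ.subdivide p (SimpleGraph.starGraph 1)).IsSplitTree (addVertex G S)) := by
  refine ⟨?_, ?_, fun p hp => hΓ.subdivide_top hp.1 hp.2, fun p hp => hΓ.subdivide_star hp.1 hp.2⟩
  · rintro u (hu | hu | ⟨hu, hprime⟩)
    · exact hΓ.addMarker_of_isPerfectClique hu.1
    · exact hΓ.addMarker_of_isEmptyStar hu.1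
    · exact hΓ.addMarker_of_isHybrid hu.1 hprime
  · rintro u ⟨hu, -⟩ hd
    -- Since `q'` is always perfect, it is never empty; this excludes two empty extremities and
    -- makes the alternative with centre `1` vacuous.
    have hq' := hΓ.isPerfect_splitExt' hu hd
    have hne := hΓ.not_isEmptyState_of_isPerfect_starSplit hu hd hq'
    exact ⟨(hΓ.isNodeSplit_starSplit hu hd).isSplit,
      hΓ.isPerfect_or_isEmptyState_splitExt hu hd, Or.inl hq', fun he => hne he.2,
      fun hp _ => hΓ.subdivide_starSplit_top hu hd hp,
      fun he => hΓ.subdivide_starSplit_star hu hd he, fun he => absurd he hne⟩
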